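/- Let $d$ be a positive integer with $3\nmid d$, and put $F_0=\mathbf Q(\sqrt{-d})$, $K_0=\mathbf Q(\sqrt{3d})$, $L_0=\mathbf Q(\sqrt{-d},\sqrt{3d})$. Let $\mathbf B_1=\mathbf Q(\zeta_9+\zeta_9^{-1})$ be the first level of the cyclotomic $\mathbf Z_3$-extension of $\mathbf Q$, and put $F_1=F_0\mathbf B_1$, $K_1=K_0\mathbf B_1$, $L_1=L_0\mathbf B_1$ (all fields are subfields of $\mathbf C$). Let $g$ generate $\mathrm{Gal}(K_1/\mathbf B_1)$ and let $\tau$ generate $\mathrm{Gal}(K_1/K_0)$. Let $E$ be the unit group of the ring of integers of $K_1$ and let $M=(E/E^3)^{1-g}$, an $\mathbf F_3$-vector space. Let $\varepsilon_0>1$ be the fundamental unit of $K_0$, and let $\varepsilon_1,\varepsilon_2\in E$ be such that (the classes of) $\varepsilon_0,\varepsilon_1,\varepsilon_2$ form a basis of $M$, $\varepsilon_2^{1-\tau}=\varepsilon_1$, and $\varepsilon_2^{1+\tau+\tau^2}=\varepsilon_0$ or $\varepsilon_2^{1+\tau+\tau^2}=1$. For $i=1,2,3$ let $\widetilde H_i=L_1(\varepsilon_0^{1/3},\dots,\varepsilon_{i-1}^{1/3})$.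 Then $\mathrm{Gal}(\widetilde H_i/F_1)$ contains exactly one element of order $2$; let $H_i$ be its fixed field. There is an extension $H_i'/F_0$ (inside $\mathbf C$) with $[H_i':F_0]=3^i$ such that $H_i=F_1H_i'$. -/

import Mathlib

open scoped NumberField IntermediateField

noncomputable section

namespace KummerLambda

/-! All fields are subfields of `ℂ`. -/

/-- `F₀ = ℚ(√-d)`. -/
def F0 (d : ℕ) : IntermediateField ℚ ℂ := ℚ⟮((Real.sqrt d : ℝ) : ℂ) * Complex.I⟯

/-- `K₀ = ℚ(√(3d))`. -/
def K0 (d : ℕ) : IntermediateField ℚ ℂ := ℚ⟮((Real.sqrt (3 * d) : ℝ) : ℂ)⟯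

/-- `L₀ = ℚ(√-d, √(3d))`. -/
def L0 (d : ℕ) : IntermediateField ℚ ℂ := F0 d ⊔ K0 d

/-- The primitive ninth root of unity `ζ₉ = exp(2πi/9)`. -/
def zeta9 : ℂ := Complex.exp (2 * Real.pi * Complex.I / 9)

/-- `B₁ = ℚ(ζ₉ + ζ₉⁻¹)`, the cubic subfield of `ℚ(ζ₉)`: the first level of the
cyclotomic `ℤ₃`-extension of `ℚ`. -/
def B1 : IntermediateField ℚ ℂ := ℚ⟮zeta9 + zeta9⁻¹⟯

/-- `F₁ = F₀ B₁`. -/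
def F1 (d : ℕ) : IntermediateField ℚ ℂ := F0 d ⊔ B1

/-- `K₁ = K₀ B₁`. -/
def K1 (d : ℕ) : IntermediateField ℚ ℂ := K0 d ⊔ B1

/-- `L₁ = L₀ B₁`. -/
def L1 (d : ℕ) : IntermediateField ℚ ℂ := L0 d ⊔ B1

lemma K0_le_K1 (d : ℕ) : K0 d ≤ K1 d := le_sup_left

/-- The automorphism `s` of `K` is trivial on the subfield `k` of `K`, that is,
`s ∈ Gal(K/k)`. -/
def Fixes {K : IntermediateField ℚ ℂ} (s : K ≃ₐ[ℚ] K) (k : IntermediateField ℚ ℂ) : Prop :=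
  ∀ x : K, (x : ℂ) ∈ k → s x = x

/-- `⟨s⟩ = Gal(K/k)`, for a subfield `k` of `K`. -/
def GeneratesGal {K : IntermediateField ℚ ℂ} (s : K ≃ₐ[ℚ] K) (k : IntermediateField ℚ ℂ) : Prop :=
  ∀ t : K ≃ₐ[ℚ] K, t ∈ Subgroup.zpowers s ↔ Fixes t k

/-- The fundamental unit of the real quadratic field `K₀`: the unit `ε₀ > 1` such that
every unit of `K₀` is `± ε₀ ^ n` for some `n ∈ ℤ`. -/
def IsFundamentalUnit {d : ℕ} (e : (𝓞 (K0 d))ˣ) : Prop :=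
  1 < (((e : 𝓞 (K0 d)) : K0 d) : ℂ).re ∧
    ∀ u : (𝓞 (K0 d))ˣ, ∃ n : ℤ, u = e ^ n ∨ u = -e ^ n

/-- `E`, the unit group of the ring of integers of `K₁`. -/
abbrev E (d : ℕ) : Type := (𝓞 (K1 d))ˣ

/-- The map induced on units of rings of integers by a homomorphism of fields. -/
def unitsMap {K L : Type*} [Field K] [Field L] (f : K →+* L) : (𝓞 K)ˣ →* (𝓞 L)ˣ :=
  Units.map (NumberField.RingOfIntegers.mapRingHom f).toMonoidHom

/-- The inclusion of the units of `K₀` into the units of `K₁`. -/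
def unitsIncl (d : ℕ) : (𝓞 (K0 d))ˣ →* E d :=
  unitsMap (IntermediateField.inclusion (K0_le_K1 d)).toRingHom

/-- The action of an automorphism of `K₁` on `E`. -/
def act {d : ℕ} (s : K1 d ≃ₐ[ℚ] K1 d) : E d →* E d :=
  unitsMap (s : K1 d →+* K1 d)

/-- The subgroup `E³` of `E`. -/
def cubes (d : ℕ) : Subgroup (E d) := (powMonoidHom 3 : E d →* E d).range

/-- `M = (E/E³)^(1-g)`, the image of `u ↦ u / g(u)` on `E/E³`. -/
def M {d : ℕ} (g : K1 d ≃ₐ[ℚ] K1 d) : Subgroup (E d ⧸ cubes d) :=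
  ((MonoidHom.id (E d) / act g).range).map (QuotientGroup.mk' (cubes d))

/-- The classes of `ε₀, ε₁, ε₂` in `E/E³` form a basis of the `𝔽₃`-vector space `M`
(written multiplicatively). -/
def IsBasisM {d : ℕ} (g : K1 d ≃ₐ[ℚ] K1 d) (ε : Fin 3 → E d) : Prop :=
  (∀ j, QuotientGroup.mk' (cubes d) (ε j) ∈ M g) ∧
    ∀ m ∈ M g, ∃! c : Fin 3 → Fin 3, m = ∏ j, QuotientGroup.mk' (cubes d) (ε j) ^ (c j : ℕ)

/-- `(ε₀, ε₁, ε₂)` is a system of special units: `ε₀` is the fundamental unit of `K₀`,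
the three units form a basis of `M`, `ε₂^(1-τ) = ε₁`, and
`ε₂^(1+τ+τ²)` is `ε₀` or `1`. -/
structure IsSpecialSystem {d : ℕ} (g τ : K1 d ≃ₐ[ℚ] K1 d) (ε : Fin 3 → E d) : Prop where
  fundamental : ∃ e : (𝓞 (K0 d))ˣ, IsFundamentalUnit e ∧ ε 0 = unitsIncl d e
  basis : IsBasisM g ε
  one_sub : ε 2 / act τ (ε 2) = ε 1
  norm : ε 2 * act τ (ε 2) * act τ (act τ (ε 2)) = ε 0 ∨
    ε 2 * act τ (ε 2) * act τ (act τ (ε 2)) = 1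

/-- `H̃ᵢ = L₁(ε₀^(1/3), …, ε_{i-1}^(1/3))`. All complex cube roots are adjoined; since `L₁`
contains the cube roots of unity, this is the same as adjoining one of each. -/
def Htilde (d : ℕ) (ε : Fin 3 → E d) (i : ℕ) : IntermediateField ℚ ℂ :=
  L1 d ⊔ IntermediateField.adjoin ℚ
    {x : ℂ | ∃ j : Fin 3, (j : ℕ) < i ∧ x ^ 3 = (((ε j : 𝓞 (K1 d)) : K1 d) : ℂ)}

/-- The fixed field of an automorphism `s` of `K`, as a subfield of `ℂ`. -/
def fixedFieldOf {K : IntermediateField ℚ ℂ} (s : K ≃ₐ[ℚ] K) : IntermediateField ℚ ℂ :=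
  IntermediateField.lift (IntermediateField.fixedField (Subgroup.zpowers s))

end KummerLambda

end

/-! Write αⱼ for a cube root of εⱼ and ω for a primitive cube root of unity; ω lies in L₁. The εⱼ
are independent modulo cubes in K₁, and since K₁ is the real subfield of L₁ they stay independent in
L₁ (`exists_cube_root_mem_K1`). By Kummer theory A = Gal(H̃ᵢ/L₁) is elementary abelian of order 3^i
(`natCard_kummer_group`).

Lift g to an automorphism S of H̃ᵢ fixing √-d. Then S inverts ω, and it inverts the classes of the
εⱼ modulo cubes, because these lie in the image of 1 - g. The two inversions cancel in the Kummer
pairing, so S centralises A (`mul_comm_of_flip`). Hence Gal(H̃ᵢ/F₁) is the product of A and a group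
of order 2, with a single involution γ.

Let T lift τ and fix √-d. Conjugation by T preserves Gal(H̃ᵢ/F₁), hence fixes γ. If T³ = 1, the
group ⟨γT⟩ is cyclic of order 6 and meets Gal(H̃ᵢ/F₁) exactly in ⟨γ⟩, because T moves ζ₉ + ζ₉⁻¹. Its
fixed field H' therefore satisfies F₁H' = Hᵢ (`InvertedKummerTower.exists_descent`), and [H̃ᵢ : ℚ] =
12·3^i gives [H' : F₀] = 3^i.

It remains to find a lift of order three (`exists_lift_of_order_three`). Multiplying by an element
of A makes T fix α₀. The norm of ε₂ is then the cube of a T-fixed element α₀^n with n = 0 or 1, and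
together with ε₁ = ε₂/τ(ε₂) this forces T³ to fix α₁ and α₂ for every choice of roots of unity. -/

open scoped NumberField IntermediateField

namespace KummerLambda

open IntermediateField

/-! ### Normality, restriction and extension of automorphisms for subfields of a fixed field -/

section Subfields

variable {F Ω : Type*} [Field F] [Field Ω] [Algebra F Ω]

lemma forall_mem_of_generators {S : Set Ω} {K : IntermediateField F Ω}
    (hK : K = adjoin F S) (φ : K →ₐ[F] Ω) (h : ∀ x : K, (x : Ω) ∈ S → φ x ∈ K) (x : K) :
    φ x ∈ K := by
  have hle : K ≤ lift (K.comap φ) := by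
    conv_lhs => rw [hK]
    rw [adjoin_le_iff]
    intro y hy
    have hyK : y ∈ K := hK ▸ subset_adjoin F S hy
    exact (mem_lift (⟨y, hyK⟩ : K)).2 (h ⟨y, hyK⟩ hy)
  exact (mem_lift x).1 (hle x.2)

/-- The roots of the minimal polynomial of `x` are its images under embeddings of `K`, so normality
means that embeddings preserve `K`, which can be tested on generators. -/
lemma normal_of_generators [IsAlgClosed Ω] {S : Set Ω} {K : IntermediateField F Ω}
    (hK : K = adjoin F S) [FiniteDimensional F K]
    (h : ∀ φ : K →ₐ[F] Ω, ∀ x : K, (x : Ω) ∈ S → φ x ∈ K) :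
    Normal F K := by
  refine ⟨fun x => ?_⟩
  refine splits_of_splits (IsAlgClosed.splits _) fun y hy => ?_
  have hr := Algebra.IsAlgebraic.range_eval_eq_rootSet_minpoly (F := F) (K := K) Ω x
  rw [← hr] at hy
  obtain ⟨φ, rfl⟩ := hy
  exact forall_mem_of_generators hK φ (h φ) x

lemma exists_restrict {k K : IntermediateField F Ω} (hle : k ≤ K) [Normal F k]
    (s : K →ₐ[F] Ω) : ∃ t : k ≃ₐ[F] k, ∀ x : k, ((t x : k) : Ω) = s (inclusion hle x) :=
  ⟨AlgHom.restrictNormal' (s.comp (inclusion hle)) k, fun x =>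
    AlgHom.restrictNormal_commutes (s.comp (inclusion hle)) k x⟩

lemma exists_extend {k K : IntermediateField F Ω} (hle : k ≤ K) [Normal F K]
    (t : k ≃ₐ[F] k) :
    ∃ s : K ≃ₐ[F] K, ∀ x : k, s (inclusion hle x) = inclusion hle (t x) := by
  let : Algebra k K := (inclusion hle).toAlgebra
  have : IsScalarTower F k K := IsScalarTower.of_algHom (inclusion hle)
  exact ⟨t.liftNormal K, fun x => t.liftNormal_commutes K x⟩

lemma card_fixingSubgroup_restrict_mul_finrank {K k : IntermediateField F Ω} (hle : k ≤ K)
    [FiniteDimensional F K] [IsGalois F K] :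
    Nat.card (IntermediateField.fixingSubgroup (restrict hle)) * Module.finrank F k =
      Module.finrank F K := by
  rw [IsGalois.card_fixingSubgroup_eq_finrank,
    (restrictAlgEquiv hle).toLinearEquiv.finrank_eq, mul_comm, Module.finrank_mul_finrank]

lemma orderOf_mul_finrank {K k : IntermediateField F Ω} (hle : k ≤ K)
    [FiniteDimensional F K] [IsGalois F K] {s : K ≃ₐ[F] K}
    (hs : ∀ t : K ≃ₐ[F] K, t ∈ Subgroup.zpowers s ↔ ∀ x : K, (x : Ω) ∈ k → t x = x) :
    orderOf s * Module.finrank F k = Module.finrank F K := by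
  have h : Subgroup.zpowers s = IntermediateField.fixingSubgroup (restrict hle) := by
    ext t
    rw [hs t, IntermediateField.mem_fixingSubgroup_iff]
    exact forall_congr' fun x => by rw [mem_restrict]
  rw [← Nat.card_zpowers, h, card_fixingSubgroup_restrict_mul_finrank]

lemma closure_pair_eq_top {G : Type*} [Group G] [Finite G] {g t : G} {m n : ℕ}
    (hg : orderOf g = m) (ht : orderOf t = n) (hmn : m.Coprime n) (hG : Nat.card G = m * n) :
    Subgroup.closure {g, t} = ⊤ := by
  apply Subgroup.eq_top_of_card_eq
  apply Nat.dvd_antisymm (Subgroup.card_subgroup_dvd_card _)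
  rw [hG]
  refine hmn.mul_dvd_of_dvd_of_dvd ?_ ?_
  · rw [← hg]; exact Subgroup.orderOf_dvd_natCard _ (Subgroup.subset_closure (by simp))
  · rw [← ht]; exact Subgroup.orderOf_dvd_natCard _ (Subgroup.subset_closure (by simp))

end Subfields

/-! ### Kummer theory of exponent 3 -/

section Kummer

variable {F K : Type*} [Field F] [Field K] [Algebra F K]

lemma pow_val_add {z : K} (hz : z ^ 3 = 1) (a b : ZMod 3) :
    z ^ (a + b).val = z ^ a.val * z ^ b.val := by
  rw [ZMod.val_add, ← pow_add, ← pow_eq_pow_mod _ hz]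

lemma pow_val_mul {z : K} (hz : z ^ 3 = 1) (a b : ZMod 3) :
    z ^ (a * b).val = (z ^ a.val) ^ b.val := by
  rw [ZMod.val_mul, ← pow_mul, ← pow_eq_pow_mod _ hz]

lemma pow_val_sum {z : K} (hz : z ^ 3 = 1) {ι : Type*} (s : Finset ι) (f : ι → ZMod 3) :
    z ^ (∑ j ∈ s, f j).val = ∏ j ∈ s, z ^ (f j).val := by
  classical
  induction s using Finset.induction_on with
  | empty => simp
  | insert a s ha ih => rw [Finset.sum_insert ha, Finset.prod_insert ha, pow_val_add hz, ih]

lemma exists_pow_val_of_pow_three_eq {z : K} (hz : IsPrimitiveRoot z 3) {x y : K} (hy : y ≠ 0)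
    (h : x ^ 3 = y ^ 3) : ∃ w : ZMod 3, x = z ^ w.val * y := by
  obtain ⟨i, hi, h⟩ := hz.eq_pow_of_pow_eq_one (ξ := x / y) (by rw [div_pow, h]; field_simp)
  refine ⟨i, ?_⟩
  rw [ZMod.val_natCast, Nat.mod_eq_of_lt hi, h]
  field_simp

lemma pow_val_injective {z : K} (hz : IsPrimitiveRoot z 3) {a b : ZMod 3}
    (h : z ^ a.val = z ^ b.val) : a = b :=
  ZMod.val_injective 3 (hz.pow_inj a.val_lt b.val_lt h)

/-- If no nontrivial product of the `α j` is fixed by the group `A` of automorphisms, which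
multiplies each of them by cube roots of unity, then all systems of cube roots of unity occur. -/
lemma exists_kummer_automorphism {ι : Type*} [Fintype ι] {A : Subgroup (K ≃ₐ[F] K)} {z : K}
    (hz : IsPrimitiveRoot z 3) (hAz : ∀ s ∈ A, s z = z) {α : ι → K}
    (hA : ∀ s ∈ A, ∀ j, ∃ w : ZMod 3, s (α j) = z ^ w.val * α j)
    (hind : ∀ c : ι → ZMod 3, (∀ s ∈ A, s (∏ j, α j ^ (c j).val) = ∏ j, α j ^ (c j).val) → c = 0)
    (w : ι → ZMod 3) : ∃ s ∈ A, ∀ j, s (α j) = z ^ (w j).val * α j := by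
  classical
  let W : AddSubgroup (ι → ZMod 3) :=
    { carrier := {w | ∃ s ∈ A, ∀ j, s (α j) = z ^ (w j).val * α j}
      zero_mem' := ⟨1, A.one_mem, by simp⟩
      add_mem' := by
        rintro w w' ⟨s, hs, h⟩ ⟨s', hs', h'⟩
        refine ⟨s * s', A.mul_mem hs hs', fun j => ?_⟩
        rw [AlgEquiv.mul_apply, h', map_mul, map_pow, hAz s hs, h, Pi.add_apply,
          pow_val_add hz.pow_eq_one]
        ring
      neg_mem' := by
        rintro w ⟨s, hs, h⟩
        refine ⟨s⁻¹, A.inv_mem hs, fun j => ?_⟩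
        apply s.injective
        rw [← AlgEquiv.mul_apply, mul_inv_cancel, AlgEquiv.one_apply, map_mul, map_pow, hAz s hs, h,
          ← mul_assoc, ← pow_val_add hz.pow_eq_one]
        simp }
  suffices h : AddSubgroup.toZModSubmodule 3 W = ⊤ by
    have : w ∈ AddSubgroup.toZModSubmodule 3 W := h ▸ Submodule.mem_top
    exact this
  by_contra hne
  -- Duality over 𝔽₃: a proper subspace of realised exponent vectors is killed by a nonzero
  -- functional, and the coefficients of that functional give a product of the `α j` fixed by all of
  -- `A`.
  obtain ⟨f, hf0, hf⟩ := Submodule.exists_le_ker_of_lt_top _ (lt_top_iff_ne_top.2 hne)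
  apply hf0
  have hc : (fun j => f (Pi.single j 1)) = 0 := by
    apply hind
    intro s hs
    choose v hv using hA s hs
    have hvW : v ∈ AddSubgroup.toZModSubmodule 3 W := ⟨s, hs, hv⟩
    have h0 : f v = 0 := hf hvW
    have hsum : ∑ j, v j * f (Pi.single j 1) = 0 := by
      rw [← h0, LinearMap.pi_apply_eq_sum_univ f v]
      refine Finset.sum_congr rfl fun j _ => ?_
      rw [smul_eq_mul]
      congr 2
      ext k
      simp [Pi.single_apply, eq_comm]
    rw [map_prod]
    simp_rw [map_pow, hv, mul_pow]
    rw [Finset.prod_mul_distrib]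
    simp_rw [← pow_val_mul hz.pow_eq_one]
    rw [← pow_val_sum hz.pow_eq_one, hsum]
    simp
  refine LinearMap.pi_ext' fun j => ?_
  ext
  simpa using congrFun hc j

/-- An element of `A` is determined by its vector of exponents, and every vector occurs, so `A` is
in bijection with `ι → ZMod 3`. -/
lemma natCard_kummer_group {ι : Type*} [Fintype ι] {A : Subgroup (K ≃ₐ[F] K)} {z : K}
    (hz : IsPrimitiveRoot z 3) (hAz : ∀ s ∈ A, s z = z) {α : ι → K} (hα : ∀ j, α j ≠ 0)
    (hA : ∀ s ∈ A, ∀ j, ∃ w : ZMod 3, s (α j) = z ^ w.val * α j)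
    (hind : ∀ c : ι → ZMod 3, (∀ s ∈ A, s (∏ j, α j ^ (c j).val) = ∏ j, α j ^ (c j).val) → c = 0)
    (hfaith : ∀ s ∈ A, (∀ j, s (α j) = α j) → s = 1) :
    Nat.card A = 3 ^ Fintype.card ι := by
  choose f hfA hf using exists_kummer_automorphism hz hAz hA hind
  have hb : Function.Bijective (fun w : ι → ZMod 3 => (⟨f w, hfA w⟩ : A)) := by
    constructor
    · intro w w' h
      have h' : f w = f w' := congrArg Subtype.val h
      funext j
      apply pow_val_injective hz
      apply mul_right_cancel₀ (hα j)
      rw [← hf, ← hf, h']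
    · rintro ⟨s, hs⟩
      choose v hv using hA s hs
      refine ⟨v, Subtype.ext ?_⟩
      have h1 : (f v)⁻¹ * s = 1 := by
        refine hfaith _ (A.mul_mem (A.inv_mem (hfA v)) hs) fun j => ?_
        rw [AlgEquiv.mul_apply, hv, ← hf v j, ← AlgEquiv.mul_apply, inv_mul_cancel,
          AlgEquiv.one_apply]
      exact (inv_mul_eq_one.1 h1)
  rw [← Nat.card_congr (Equiv.ofBijective _ hb), Nat.card_fun, Nat.card_zmod,
    Nat.card_eq_fintype_card]

end Kummer

/-! ### The unique involution and the descent of its fixed field -/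

section Involution

variable {F K : Type*} [Field F] [Field K] [Algebra F K]

/-- The Galois-theoretic data of the tower `K / F(r, q, b) / F(r, b)`: `K` is generated over the
field `F(r, q, b)` by elements `α j`, which are multiplied by cube roots of unity by the
automorphisms over `F(r, q, b)`, and `F(r, q, b) / F(r, b)` is quadratic and acts by inversion on
the Kummer classes of the `α j`. -/
structure InvertedKummerTower (F : Type*) {K : Type*} [Field F] [Field K] [Algebra F K]
    {ι : Type*} (r q b z : K) (α : ι → K) : Prop where
  root : IsPrimitiveRoot z 3
  sign : ∀ s : K ≃ₐ[F] K, s q = q ∨ s q = -q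
  ne_neg : q ≠ -q
  fix_root : ∀ s : K ≃ₐ[F] K, s r = r → s q = q → s z = z
  inv_root : ∀ s : K ≃ₐ[F] K, s r = r → s q = -q → s z = z ^ 2
  ne_zero : ∀ j, α j ≠ 0
  faithful : ∀ s : K ≃ₐ[F] K, s r = r → s q = q → s b = b → (∀ j, s (α j) = α j) → s = 1
  kummer : ∀ s : K ≃ₐ[F] K, s r = r → s q = q → s b = b →
    ∀ j, ∃ w : ZMod 3, s (α j) = z ^ w.val * α j
  inverted : ∀ s : K ≃ₐ[F] K, s r = r → s q = -q → s b = b → ∀ j, ∃ v : K,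
    (∀ t : K ≃ₐ[F] K, t r = r → t q = q → t b = b → t v = v) ∧ s (α j) = (α j)⁻¹ * v
  flip : ∃ s : K ≃ₐ[F] K, s r = r ∧ s b = b ∧ s q = -q

namespace InvertedKummerTower

variable {ι : Type*} {r q b z : K} {α : ι → K}

lemma ext_aut (D : InvertedKummerTower F r q b z α) {s t : K ≃ₐ[F] K} (hr : s r = t r)
    (hq : s q = t q) (hb : s b = t b) (hα : ∀ j, s (α j) = t (α j)) : s = t := by
  have key : ∀ x, s x = t x → (t⁻¹ * s) x = x := by
    intro x hx
    rw [AlgEquiv.mul_apply, hx, ← AlgEquiv.mul_apply, inv_mul_cancel, AlgEquiv.one_apply]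
  exact (inv_mul_eq_one.1 (D.faithful (t⁻¹ * s) (key _ hr) (key _ hq) (key _ hb)
    fun j => key _ (hα j))).symm

lemma pow_three_eq_one (D : InvertedKummerTower F r q b z α) {a : K ≃ₐ[F] K} (hr : a r = r)
    (hq : a q = q) (hb : a b = b) : a ^ 3 = 1 := by
  apply D.ext_aut
  · simp [pow_succ, hr]
  · simp [pow_succ, hq]
  · simp [pow_succ, hb]
  · intro j
    obtain ⟨w, hw⟩ := D.kummer a hr hq hb j
    have hz := D.fix_root a hr hq
    have h3 : (z ^ w.val) ^ 3 = 1 := by rw [← pow_mul, mul_comm, pow_mul, D.root.pow_eq_one, one_pow]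
    simp only [pow_succ, pow_zero, one_mul, AlgEquiv.mul_apply, AlgEquiv.one_apply, hw, map_mul,
      map_pow, hz]
    linear_combination (α j) * h3

/-- Two inversions cancel. If `a` multiplies `α j` by ξ and `s (α j) = (α j)⁻¹ * v`, then `s ∘ a`
gives ξ² (α j)⁻¹ v, while `a ∘ s` gives ξ⁻¹ (α j)⁻¹ v; these agree since ξ³ = 1. -/
lemma mul_comm_of_flip (D : InvertedKummerTower F r q b z α) {s a : K ≃ₐ[F] K} (hsr : s r = r)
    (hsq : s q = -q) (hsb : s b = b) (hr : a r = r) (hq : a q = q) (hb : a b = b) :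
    s * a = a * s := by
  apply D.ext_aut
  · simp [hr, hsr]
  · simp [hq, hsq]
  · simp [hb, hsb]
  · intro j
    obtain ⟨w, hw⟩ := D.kummer a hr hq hb j
    obtain ⟨v, hv, hsv⟩ := D.inverted s hsr hsq hsb j
    have hz3 : (z ^ w.val) ^ 3 = 1 := by
      rw [← pow_mul, mul_comm, pow_mul, D.root.pow_eq_one, one_pow]
    have hne : z ^ w.val ≠ 0 := pow_ne_zero _ (D.root.ne_zero (by norm_num))
    have hα := D.ne_zero j
    rw [AlgEquiv.mul_apply, AlgEquiv.mul_apply, hw, hsv, map_mul, map_mul, map_inv₀, hw, hsv,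
      hv a hr hq hb, map_pow, D.inv_root s hsr hsq, ← pow_mul, mul_comm 2, pow_mul]
    field_simp
    rw [hz3, one_mul]

/-- For a flip `S`, the square `S ^ 2` lies in a group of exponent 3, so `S ^ 3` is an involution.
Any other involution must also flip `q`; its product with `S ^ 3` then has exponent 3, and exponent
2 because the factors commute, so it is trivial. -/
lemma exists_unique_involution (D : InvertedKummerTower F r q b z α) :
    ∃ γ : K ≃ₐ[F] K, ∀ s : K ≃ₐ[F] K, ((s r = r ∧ s b = b) ∧ orderOf s = 2) ↔ s = γ := by
  obtain ⟨S, hSr, hSb, hSq⟩ := D.flip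
  have hSS : (S ^ 2) ^ 3 = 1 :=
    D.pow_three_eq_one (by simp [pow_succ, hSr]) (by simp [pow_succ, hSq]) (by simp [pow_succ, hSb])
  have hγr : (S ^ 3) r = r := by simp [pow_succ, hSr]
  have hγb : (S ^ 3) b = b := by simp [pow_succ, hSb]
  have hγq : (S ^ 3) q = -q := by simp [pow_succ, hSq]
  have hγ2 : (S ^ 3) ^ 2 = 1 := by rw [← pow_mul, mul_comm, pow_mul, hSS]
  refine ⟨S ^ 3, fun s => ⟨?_, ?_⟩⟩
  · rintro ⟨⟨hr, hb⟩, ho⟩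
    have hs2 : s ^ 2 = 1 := by rw [← ho, pow_orderOf_eq_one]
    have hsq : s q = -q := by
      refine (D.sign s).resolve_left fun hq => ?_
      have h3 := D.pow_three_eq_one hr hq hb
      have : s = 1 := by rwa [pow_succ, hs2, one_mul] at h3
      rw [this, orderOf_one] at ho
      norm_num at ho
    generalize S ^ 3 = γ at *
    have har : (γ * s) r = r := by simp [hr, hγr]
    have haq : (γ * s) q = q := by simp [hsq, hγq]
    have hab : (γ * s) b = b := by simp [hb, hγb]
    have hc := D.mul_comm_of_flip hγr hγq hγb har haq hab
    have hc' : γ * s = s * γ := mul_left_cancel (a := γ) (by rw [hc, mul_assoc])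
    have ha2 : (γ * s) ^ 2 = 1 := by
      rw [pow_two]
      calc γ * s * (γ * s) = γ * (s * γ) * s := by group
        _ = γ ^ 2 * s ^ 2 := by rw [← hc']; simp only [pow_two, mul_assoc]
        _ = 1 := by rw [hγ2, hs2, one_mul]
    have ha3 := D.pow_three_eq_one har haq hab
    rw [pow_succ, ha2, one_mul] at ha3
    calc s = γ ^ 2 * s := by rw [hγ2, one_mul]
      _ = γ * (γ * s) := by rw [pow_two, mul_assoc]
      _ = γ := by rw [ha3, mul_one]
  · rintro rfl
    refine ⟨⟨hγr, hγb⟩, orderOf_eq_prime hγ2 fun h => D.ne_neg ?_⟩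
    rw [h] at hγq
    exact hγq

/-- If the generator of the cubic extension `F(b)` lifts to an automorphism of order three, then the
fixed field of the unique involution descends. -/
theorem exists_descent [FiniteDimensional F K] [IsGalois F K]
    (D : InvertedKummerTower F r q b z α)
    {T : K ≃ₐ[F] K} (hTr : T r = r) (hTb : T b ≠ b) (hT : T ^ 3 = 1)
    (hTb' : ∀ s : K ≃ₐ[F] K, s b = b → s (T b) = T b) :
    ∃ γ : K ≃ₐ[F] K, (∀ s : K ≃ₐ[F] K, ((s r = r ∧ s b = b) ∧ orderOf s = 2) ↔ s = γ) ∧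
      ∃ H : IntermediateField F K, r ∈ H ∧ Module.finrank H K = 6 ∧
        fixedField (Subgroup.zpowers γ) = adjoin F {r, b} ⊔ H := by
  obtain ⟨γ, hγ⟩ := D.exists_unique_involution
  obtain ⟨⟨hγr, hγb⟩, hγo⟩ := (hγ γ).2 rfl
  have hTi : ∀ x, T⁻¹ (T x) = x := fun x => by
    rw [← AlgEquiv.mul_apply, inv_mul_cancel, AlgEquiv.one_apply]
  have hcomm : Commute γ T := by
    -- The conjugate again fixes `r` and `b` (here `γ` must fix `T b`) and has order two, so it is
    -- `γ` by uniqueness.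
    have h : T⁻¹ * γ * T = γ := by
      refine (hγ _).1 ⟨⟨?_, ?_⟩, ?_⟩
      · rw [AlgEquiv.mul_apply, AlgEquiv.mul_apply, hTr, hγr]
        conv_lhs => rw [← hTr]
        exact hTi r
      · rw [AlgEquiv.mul_apply, AlgEquiv.mul_apply, hTb' γ hγb, hTi]
      · rw [← hγo]
        simpa using (MulAut.conj T⁻¹).orderOf_eq γ
    calc γ * T = T * (T⁻¹ * γ * T) := by group
      _ = T * γ := by rw [h]
  have hTo : orderOf T = 3 := orderOf_eq_prime hT fun h => hTb (by rw [h]; rfl)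
  have hγ2 : γ ^ 2 = 1 := by rw [← hγo, pow_orderOf_eq_one]
  have hpo : orderOf (γ * T) = 6 := by
    rw [hcomm.orderOf_mul_eq_mul_orderOf_of_coprime (by rw [hγo, hTo]; norm_num), hγo, hTo]
  have hγp : γ ∈ Subgroup.zpowers (γ * T) := by
    refine ⟨3, ?_⟩
    change (γ * T) ^ ((3 : ℕ) : ℤ) = γ
    rw [zpow_natCast, hcomm.mul_pow, hT, mul_one, pow_succ, hγ2, one_mul]
  have hfixb : ∀ n : ℕ, (γ ^ n) b = b := by
    intro n
    induction n with
    | zero => simp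
    | succ n ih => rw [pow_succ, AlgEquiv.mul_apply, hγb, ih]
  have hTn : ∀ n : ℕ, (T ^ n) b = b → T ^ n = 1 := by
    intro n hn
    rw [pow_eq_pow_mod n hT] at hn ⊢
    have hlt := Nat.mod_lt n (show 3 > 0 by norm_num)
    interval_cases n % 3
    · simp
    · exact absurd (by simpa using hn) hTb
    · exfalso
      apply hTb
      have h := congrArg T hn
      rw [← AlgEquiv.mul_apply, ← pow_succ', hT] at h
      exact h.symm
  -- On the Galois side: a power `(γ * T) ^ n` fixing `b` has `T ^ n` fixing `b`, hence `T ^ n = 1`,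
  -- and only `γ ^ n` is left.
  have hle : fixingSubgroup (adjoin F {r, b} ⊔ fixedField (Subgroup.zpowers (γ * T))) ≤
      Subgroup.zpowers γ := by
    rw [IntermediateField.fixingSubgroup_sup, IntermediateField.fixingSubgroup_fixedField]
    rintro x ⟨hx1, hx2⟩
    have hxb : x b = b :=
      (IntermediateField.mem_fixingSubgroup_iff _ x).1 hx1 b (subset_adjoin F _ (by simp))
    obtain ⟨n, rfl⟩ := (mem_powers_iff_mem_zpowers).2 hx2
    simp only [hcomm.mul_pow] at hxb ⊢
    have h1 : T ^ n = 1 := by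
      apply hTn
      rw [(hcomm.pow_pow n n).eq, AlgEquiv.mul_apply, hfixb] at hxb
      exact hxb
    rw [h1, mul_one]
    exact Subgroup.npow_mem_zpowers γ n
  refine ⟨γ, hγ, fixedField (Subgroup.zpowers (γ * T)), ?_, ?_, ?_⟩
  · rw [mem_fixedField_iff]
    intro x hx
    obtain ⟨n, rfl⟩ := (mem_powers_iff_mem_zpowers).2 hx
    have hp : (γ * T) r = r := by rw [AlgEquiv.mul_apply, hTr, hγr]
    induction n with
    | zero => simp
    | succ n ih =>
      simp only [pow_succ, AlgEquiv.mul_apply] at ih ⊢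
      rw [hTr, hγr]
      exact ih (Subgroup.npow_mem_zpowers _ n)
  · rw [finrank_fixedField_eq_card, Nat.card_zpowers, hpo]
  · apply le_antisymm
    · rw [← IsGalois.fixedField_fixingSubgroup (adjoin F {r, b} ⊔ fixedField _)]
      exact fixedField_antitone hle
    · refine sup_le ?_ (fixedField_antitone ?_)
      · rw [adjoin_le_iff]
        have hfix : ∀ y, γ y = y → y ∈ fixedField (Subgroup.zpowers γ) := by
          intro y hy
          rw [mem_fixedField_iff]
          intro x hx
          obtain ⟨n, rfl⟩ := (mem_powers_iff_mem_zpowers).2 hx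
          simp only
          clear hx
          induction n with
          | zero => simp
          | succ n ih => rw [pow_succ, AlgEquiv.mul_apply, hy, ih]
        rintro y (rfl | rfl)
        · exact hfix _ hγr
        · exact hfix _ hγb
      · rw [Subgroup.zpowers_le]
        exact hγp

end InvertedKummerTower

end Involution

open Polynomial

/-! ### The fields F₀, K₀, B₁, K₁, L₁: degrees, conjugates, real elements -/

section Fields

/-- The structure of an `F`-algebra on an intermediate field. -/
@[reducible] def baseAlgebra {F Ω : Type*} [Field F] [Field Ω] [Algebra F Ω]
    (K : IntermediateField F Ω) : Algebra F K := inferInstance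

/-- The structure of an `F`-vector space on an intermediate field. -/
@[reducible] def baseModule {F Ω : Type*} [Field F] [Field Ω] [Algebra F Ω]
    (K : IntermediateField F Ω) : Module F K := inferInstance

/-- The `ℚ`-algebra structure of a subfield of `ℂ` as an intermediate field. -/
@[reducible] noncomputable def ratAlgebra (K : IntermediateField ℚ ℂ) : Algebra ℚ K :=
  baseAlgebra K

/-- The structure of a `ℚ`-vector space on a subfield of `ℂ`. -/
@[reducible] noncomputable def ratModule (K : IntermediateField ℚ ℂ) : Module ℚ K := baseModule K

attribute [local instance] ratAlgebra ratModule

lemma finrank_adjoin_of_no_root {p : ℚ[X]} (hm : p.Monic) (h2 : 2 ≤ p.natDegree)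
    (h3 : p.natDegree ≤ 3) (hr : ∀ x : ℚ, p.eval x ≠ 0) {y : ℂ} (hy : aeval y p = 0) :
    IsIntegral ℚ y ∧ Module.finrank ℚ ℚ⟮y⟯ = p.natDegree := by
  have hint : IsIntegral ℚ y := ⟨p, hm, hy⟩
  have hirr : Irreducible p := by
    rw [hm.irreducible_iff_roots_eq_zero_of_degree_le_three h2 h3]
    exact Multiset.eq_zero_of_forall_notMem fun x hx => hr x (isRoot_of_mem_roots hx)
  exact ⟨hint, by rw [adjoin.finrank hint, ← minpoly.eq_of_irreducible_of_monic hirr hy hm]⟩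

variable (d : ℕ)

/-- The generator `√-d` of `F₀`. -/
noncomputable def rF : ℂ := ((Real.sqrt d : ℝ) : ℂ) * Complex.I

/-- The generator `√(3d)` of `K₀`. -/
noncomputable def qK : ℂ := ((Real.sqrt (3 * d) : ℝ) : ℂ)

/-- The generator `ζ₉ + ζ₉⁻¹` of `B₁`. -/
noncomputable def bB : ℂ := zeta9 + zeta9⁻¹

lemma rF_sq : rF d ^ 2 = -d := by
  rw [rF, mul_pow, Complex.I_sq, ← Complex.ofReal_pow, Real.sq_sqrt (Nat.cast_nonneg d)]
  simp

lemma qK_sq : qK d ^ 2 = 3 * d := by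
  rw [qK, ← Complex.ofReal_pow, Real.sq_sqrt (by positivity)]
  push_cast
  ring

lemma conj_rF : (starRingEnd ℂ) (rF d) = -rF d := by
  simp [rF]

lemma conj_qK : (starRingEnd ℂ) (qK d) = qK d := Complex.conj_ofReal _

lemma zeta9_primitive : IsPrimitiveRoot zeta9 9 := by
  have := Complex.isPrimitiveRoot_exp 9 (by norm_num)
  simpa [zeta9] using this

lemma bB_cubic : bB ^ 3 - 3 * bB + 1 = 0 := by
  have h := zeta9_primitive
  have h0 : zeta9 ≠ 0 := h.ne_zero (by norm_num)
  have h3 : zeta9 ^ 3 - 1 ≠ 0 := sub_ne_zero.2 (h.pow_ne_one_of_pos_of_lt (by norm_num) (by norm_num))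
  have h6 : zeta9 ^ 6 + zeta9 ^ 3 + 1 = 0 := by
    apply mul_left_cancel₀ h3
    linear_combination h.pow_eq_one
  rw [bB]
  field_simp
  linear_combination h6

lemma conj_bB : (starRingEnd ℂ) bB = bB := by
  have hn : ‖zeta9‖ = 1 := zeta9_primitive.norm'_eq_one (by norm_num)
  have hc : (starRingEnd ℂ) zeta9 = zeta9⁻¹ := (Complex.inv_eq_conj hn).symm
  rw [bB, map_add, map_inv₀, hc, inv_inv, add_comm]

lemma F1_eq : F1 d = adjoin ℚ {rF d, bB} := by
  rw [F1, F0, B1, ← adjoin_union]; rfl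

lemma K1_eq : K1 d = adjoin ℚ {qK d, bB} := by
  rw [K1, K0, B1, ← adjoin_union]; rfl

lemma L1_eq : L1 d = adjoin ℚ ({rF d, qK d, bB} : Set ℂ) := by
  rw [L1, L0, F0, K0, B1, ← adjoin_union, ← adjoin_union, Set.union_assoc]; rfl

lemma rF_mem_F0 : rF d ∈ F0 d := mem_adjoin_simple_self ℚ _

lemma qK_mem_K0 : qK d ∈ K0 d := mem_adjoin_simple_self ℚ _

lemma bB_mem_B1 : bB ∈ B1 := mem_adjoin_simple_self ℚ _

lemma qK_mem_K1 : qK d ∈ K1 d := K0_le_K1 d (qK_mem_K0 d)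

lemma B1_le_K1 : B1 ≤ K1 d := le_sup_right

lemma bB_mem_K1 : bB ∈ K1 d := B1_le_K1 d bB_mem_B1

lemma K1_le_L1 : K1 d ≤ L1 d := sup_le_sup_right le_sup_right _

lemma F0_le_L1 : F0 d ≤ L1 d := le_sup_left.trans le_sup_left

lemma L1_eq_sup : L1 d = F0 d ⊔ K1 d := sup_assoc _ _ _

lemma conj_of_mem_K1 {x : ℂ} (hx : x ∈ K1 d) : (starRingEnd ℂ) x = x := by
  rw [K1_eq] at hx
  induction hx using adjoin_induction with
  | mem x hx => rcases hx with rfl | rfl; exacts [conj_qK d, conj_bB]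
  | algebraMap x => simp
  | add x y _ _ hx hy => rw [map_add, hx, hy]
  | inv x _ hx => rw [map_inv₀, hx]
  | mul x y _ _ hx hy => rw [map_mul, hx, hy]

variable {d}

lemma ne_zero_of_not_three_dvd (hd : ¬ 3 ∣ d) : d ≠ 0 := by
  rintro rfl
  exact hd (dvd_zero 3)

lemma rF_ne_zero (hd : ¬ 3 ∣ d) : rF d ≠ 0 := by
  intro h
  have := rF_sq d
  rw [h] at this
  have h0 := ne_zero_of_not_three_dvd hd
  apply h0
  have : (d : ℂ) = 0 := by linear_combination this
  exact_mod_cast this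

lemma qK_ne_zero (hd : ¬ 3 ∣ d) : qK d ≠ 0 := by
  intro h
  have := qK_sq d
  rw [h] at this
  have h0 := ne_zero_of_not_three_dvd hd
  apply h0
  have : (d : ℂ) = 0 := by linear_combination -this / 3
  exact_mod_cast this

lemma rF_notMem_K1 (hd : ¬ 3 ∣ d) : rF d ∉ K1 d := by
  intro h
  have h1 := conj_of_mem_K1 d h
  rw [conj_rF] at h1
  exact rF_ne_zero hd (by linear_combination -h1 / 2)

lemma finrank_F0 (hd : ¬ 3 ∣ d) :
    IsIntegral ℚ (rF d) ∧ Module.finrank ℚ (F0 d) = 2 := by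
  have hdeg : (X ^ 2 + C (d : ℚ)).natDegree = 2 := by compute_degree!
  have := finrank_adjoin_of_no_root (p := X ^ 2 + C (d : ℚ)) (y := rF d) (by monicity!)
    hdeg.ge (by omega) (fun x => ?_) (by simp [rF_sq])
  · rwa [hdeg] at this
  · have : (0 : ℚ) < d := by exact_mod_cast Nat.pos_of_ne_zero (ne_zero_of_not_three_dvd hd)
    simp only [eval_add, eval_pow, eval_X, eval_C]
    positivity

lemma finrank_K0 (hd : ¬ 3 ∣ d) :
    IsIntegral ℚ (qK d) ∧ Module.finrank ℚ (K0 d) = 2 := by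
  have hdeg : (X ^ 2 - C (3 * d : ℚ)).natDegree = 2 := by compute_degree!
  have := finrank_adjoin_of_no_root (p := X ^ 2 - C (3 * d : ℚ)) (y := qK d) (by monicity!)
    hdeg.ge (by omega) (fun x => ?_) (by simp [qK_sq])
  · rwa [hdeg] at this
  · simp only [eval_sub, eval_pow, eval_X, eval_C]
    intro h
    have h0 := ne_zero_of_not_three_dvd hd
    have hx : x ^ 2 = 3 * d := by linear_combination h
    have hd0 : (d : ℚ) ≠ 0 := by exact_mod_cast h0
    have hx0 : x ≠ 0 := by
      rintro rfl
      apply hd0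
      linear_combination -hx / 3
    -- The 3-adic valuation is even on the left and 1 on the right, as 3 does not divide d.
    have hv := congrArg (padicValRat 3) hx
    have h3 : padicValRat 3 (3 : ℚ) = 1 := by
      have := padicValRat.self (p := 3) (by norm_num)
      exact_mod_cast this
    rw [padicValRat.pow, padicValRat.mul (by norm_num) hd0, h3, padicValRat.of_nat,
      padicValNat.eq_zero_of_not_dvd hd] at hv
    push_cast at hv
    omega

lemma finrank_B1 : IsIntegral ℚ bB ∧ Module.finrank ℚ B1 = 3 := by
  have hdeg : (X ^ 3 - C (3 : ℚ) * X + C 1).natDegree = 3 := by compute_degree!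
  have := finrank_adjoin_of_no_root (p := X ^ 3 - C (3 : ℚ) * X + C 1) (y := bB)
    (by monicity!) (by omega) hdeg.le (fun x => ?_) (by simpa using bB_cubic)
  · rwa [hdeg] at this
  · simp only [eval_sub, eval_add, eval_mul, eval_pow, eval_X, eval_C]
    intro h
    have hint : IsIntegral ℤ x :=
      ⟨X ^ 3 - C (3 : ℤ) * X + C 1, by monicity!, by simpa using h⟩
    obtain ⟨n, rfl⟩ := IsIntegrallyClosed.isIntegral_iff.1 hint
    have hn : n ^ 3 - 3 * n + 1 = 0 := by
      simp only [algebraMap_int_eq, eq_intCast] at h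
      exact_mod_cast h
    have hdvd : n ∣ 1 := ⟨3 - n ^ 2, by linear_combination hn⟩
    rcases Int.isUnit_iff.1 (isUnit_of_dvd_one hdvd) with rfl | rfl <;> norm_num at hn

instance finiteDimensional_B1 : FiniteDimensional ℚ B1 :=
  adjoin.finiteDimensional finrank_B1.1

lemma finiteDimensional_F0 (hd : ¬ 3 ∣ d) : FiniteDimensional ℚ (F0 d) :=
  adjoin.finiteDimensional (finrank_F0 hd).1

lemma finiteDimensional_K0 (hd : ¬ 3 ∣ d) : FiniteDimensional ℚ (K0 d) :=
  adjoin.finiteDimensional (finrank_K0 hd).1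

lemma finiteDimensional_K1 (hd : ¬ 3 ∣ d) : FiniteDimensional ℚ (K1 d) := by
  have := finiteDimensional_K0 hd
  exact finiteDimensional_sup (K0 d) B1

lemma finiteDimensional_L1 (hd : ¬ 3 ∣ d) : FiniteDimensional ℚ (L1 d) := by
  have := finiteDimensional_F0 hd
  have := finiteDimensional_K1 hd
  rw [L1_eq_sup]
  exact finiteDimensional_sup (F0 d) (K1 d)

lemma finrank_K1 (hd : ¬ 3 ∣ d) : Module.finrank ℚ (K1 d) = 6 := by
  have := finiteDimensional_K0 hd
  have := finiteDimensional_K1 hd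
  have h2 : Module.finrank ℚ (K0 d) ∣ Module.finrank ℚ (K1 d) := finrank_dvd_of_le_right (K0_le_K1 d)
  have h3 : Module.finrank ℚ B1 ∣ Module.finrank ℚ (K1 d) := finrank_dvd_of_le_right (B1_le_K1 d)
  have hle : Module.finrank ℚ (K1 d) ≤ Module.finrank ℚ (K0 d) * Module.finrank ℚ B1 :=
    finrank_sup_le (K0 d) B1
  have hpos : 0 < Module.finrank ℚ (K1 d) := Module.finrank_pos
  rw [(finrank_K0 hd).2] at h2 hle
  rw [finrank_B1.2] at h3 hle
  omega

lemma finrank_L1 (hd : ¬ 3 ∣ d) : Module.finrank ℚ (L1 d) = 12 := by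
  have := finiteDimensional_F0 hd
  have := finiteDimensional_K1 hd
  have := finiteDimensional_L1 hd
  have h6 : Module.finrank ℚ (K1 d) ∣ Module.finrank ℚ (L1 d) := finrank_dvd_of_le_right (K1_le_L1 d)
  have hle : Module.finrank ℚ (L1 d) ≤ Module.finrank ℚ (F0 d) * Module.finrank ℚ (K1 d) := by
    rw [L1_eq_sup]
    exact finrank_sup_le (F0 d) (K1 d)
  have hpos : 0 < Module.finrank ℚ (L1 d) := Module.finrank_pos
  have hne : Module.finrank ℚ (K1 d) ≠ Module.finrank ℚ (L1 d) := by
    intro h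
    have := eq_of_le_of_finrank_eq (K1_le_L1 d) h
    exact rF_notMem_K1 hd (this ▸ F0_le_L1 d (rF_mem_F0 d))
  rw [(finrank_F0 hd).2] at hle
  rw [finrank_K1 hd] at h6 hle hne
  omega

/-- The other two roots are ζ₉² + ζ₉⁻² = b² - 2 and ζ₉⁴ + ζ₉⁻⁴, the latter found from the vanishing
sum of the three roots. -/
lemma eq_of_bB_cubic {x : ℂ} (hx : x ^ 3 - 3 * x + 1 = 0) :
    x = bB ∨ x = bB ^ 2 - 2 ∨ x = 2 - bB - bB ^ 2 := by
  have h : (x - bB) * ((x - (bB ^ 2 - 2)) * (x - (2 - bB - bB ^ 2))) = 0 := by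
    linear_combination hx + (bB ^ 2 + bB - 1 - x * (bB + 1)) * bB_cubic
  rcases mul_eq_zero.1 h with h | h
  · exact Or.inl (sub_eq_zero.1 h)
  · rcases mul_eq_zero.1 h with h | h
    · exact Or.inr (Or.inl (sub_eq_zero.1 h))
    · exact Or.inr (Or.inr (sub_eq_zero.1 h))

section Conjugates

variable {k : IntermediateField ℚ ℂ} (φ : k →ₐ[ℚ] ℂ) {x : k}

lemma map_rF (hx : (x : ℂ) = rF d) : φ x = rF d ∨ φ x = -rF d := by
  have h : x ^ 2 = -(d : k) := Subtype.ext (by simpa [hx] using rF_sq d)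
  have h' := congrArg φ h
  rw [map_pow, map_neg, map_natCast, ← rF_sq] at h'
  exact sq_eq_sq_iff_eq_or_eq_neg.1 h'

lemma map_qK (hx : (x : ℂ) = qK d) : φ x = qK d ∨ φ x = -qK d := by
  have h : x ^ 2 = 3 * (d : k) := Subtype.ext (by
    push_cast
    rw [hx]
    exact qK_sq d)
  have h' := congrArg φ h
  rw [map_pow, map_mul, map_natCast, map_ofNat, ← qK_sq] at h'
  exact sq_eq_sq_iff_eq_or_eq_neg.1 h'

lemma map_bB (hx : (x : ℂ) = bB) : φ x = bB ∨ φ x = bB ^ 2 - 2 ∨ φ x = 2 - bB - bB ^ 2 := by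
  have h : x ^ 3 - 3 * x + 1 = 0 := Subtype.ext (by
    push_cast
    rw [hx]
    exact bB_cubic)
  have h' := congrArg φ h
  rw [map_add, map_sub, map_pow, map_mul, map_ofNat, map_one, map_zero] at h'
  exact eq_of_bB_cubic h'

lemma map_bB_mem {K : IntermediateField ℚ ℂ} (hK : bB ∈ K) (hx : (x : ℂ) = bB) : φ x ∈ K := by
  rcases map_bB φ hx with h | h | h <;> rw [h]
  · exact hK
  · exact sub_mem (pow_mem hK 2) (ofNat_mem K 2)
  · exact sub_mem (sub_mem (ofNat_mem K 2) hK) (pow_mem hK 2)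

end Conjugates

lemma normal_K1 (hd : ¬ 3 ∣ d) : Normal ℚ (K1 d) := by
  have := finiteDimensional_K1 hd
  refine normal_of_generators (K1_eq d) fun φ x hx => ?_
  rcases hx with hx | hx
  · rcases map_qK φ hx with h | h <;> rw [h]
    · exact qK_mem_K1 d
    · exact neg_mem (qK_mem_K1 d)
  · exact map_bB_mem φ (bB_mem_K1 d) hx

lemma exists_eq_add_of_mem_L1 {x : ℂ} (hx : x ∈ L1 d) :
    ∃ u ∈ K1 d, ∃ v ∈ K1 d, x = u + v * rF d := by
  rw [L1_eq] at hx
  have hr := rF_sq d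
  induction hx using adjoin_induction with
  | mem x hx =>
    rcases hx with rfl | rfl | rfl
    · exact ⟨0, zero_mem _, 1, one_mem _, by ring⟩
    · exact ⟨_, qK_mem_K1 d, 0, zero_mem _, by ring⟩
    · exact ⟨_, bB_mem_K1 d, 0, zero_mem _, by ring⟩
  | algebraMap x => exact ⟨_, IntermediateField.algebraMap_mem _ x, 0, zero_mem _, by ring⟩
  | add x y _ _ hx hy =>
    obtain ⟨u, hu, v, hv, rfl⟩ := hx
    obtain ⟨u', hu', v', hv', rfl⟩ := hy
    exact ⟨_, add_mem hu hu', _, add_mem hv hv', by ring⟩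
  | inv x _ hx =>
    obtain ⟨u, hu, v, hv, rfl⟩ := hx
    have hn : u ^ 2 + v ^ 2 * d ∈ K1 d :=
      add_mem (pow_mem hu 2) (mul_mem (pow_mem hv 2) (_root_.natCast_mem _ d))
    have hmul : (u + v * rF d) * (u - v * rF d) = u ^ 2 + v ^ 2 * d := by
      linear_combination -v ^ 2 * hr
    by_cases h0 : u + v * rF d = 0
    · exact ⟨0, zero_mem _, 0, zero_mem _, by rw [h0]; simp⟩
    · refine ⟨_, mul_mem hu (inv_mem hn), _, neg_mem (mul_mem hv (inv_mem hn)), ?_⟩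
      -- As `u` and `v` are real and `rF d` is purely imaginary, this is the complex conjugate of a
      -- nonzero number.
      have h1 : u - v * rF d ≠ 0 := by
        intro h1
        have h2 := congrArg (starRingEnd ℂ) h1
        rw [map_sub, map_mul, conj_rF, conj_of_mem_K1 d hu, conj_of_mem_K1 d hv, map_zero] at h2
        exact h0 (by linear_combination h2)
      rw [← hmul]
      field_simp
      ring
  | mul x y _ _ hx hy =>
    obtain ⟨u, hu, v, hv, rfl⟩ := hx
    obtain ⟨u', hu', v', hv', rfl⟩ := hy
    refine ⟨u * u' - v * v' * d, ?_, u * v' + v * u', ?_, ?_⟩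
    · exact sub_mem (mul_mem hu hu') (mul_mem (mul_mem hv hv') (_root_.natCast_mem _ d))
    · exact add_mem (mul_mem hu hv') (mul_mem hv hu')
    · linear_combination v * v' * hr

lemma mem_K1_of_conj_eq {x : ℂ} (hx : x ∈ L1 d) (hc : (starRingEnd ℂ) x = x) :
    x ∈ K1 d := by
  obtain ⟨u, hu, v, hv, rfl⟩ := exists_eq_add_of_mem_L1 hx
  rw [map_add, map_mul, conj_rF, conj_of_mem_K1 d hu, conj_of_mem_K1 d hv] at hc
  have : v * rF d = 0 := by linear_combination -hc / 2
  rwa [this, add_zero]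

/-- The primitive cube root of unity `(-1 + √-3) / 2`, expressed by `√-d` and `√(3d)`. -/
def omega (d : ℕ) {k : Type*} [Field k] (r q : k) : k := (-1 + r * q / d) / 2

lemma omega_primitive {k : Type*} [Field k] [CharZero k] {r q : k} (hd : d ≠ 0)
    (hr : r ^ 2 = -d) (hq : q ^ 2 = 3 * d) : IsPrimitiveRoot (omega d r q) 3 := by
  have hd' : (d : k) ≠ 0 := by exact_mod_cast hd
  have h : omega d r q ^ 2 + omega d r q + 1 = 0 := by
    rw [omega]
    field_simp
    linear_combination q ^ 2 * hr - d * hq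
  have h3 : omega d r q ^ 3 = 1 := by linear_combination (omega d r q - 1) * h
  refine IsPrimitiveRoot.of_map_of_injective (f := MonoidHom.id k) ?_ Function.injective_id
  refine IsPrimitiveRoot.iff_orderOf.2 (orderOf_eq_prime h3 fun h1 => ?_)
  change omega d r q = 1 at h1
  rw [h1] at h
  norm_num at h

lemma omega_neg {k : Type*} [Field k] [CharZero k] {r q : k} (hd : d ≠ 0)
    (hr : r ^ 2 = -d) (hq : q ^ 2 = 3 * d) : omega d r (-q) = omega d r q ^ 2 := by
  have hd' : (d : k) ≠ 0 := by exact_mod_cast hd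
  rw [omega, omega]
  field_simp
  linear_combination -q ^ 2 * hr + d * hq

lemma exists_real_cube_root {x : ℂ} (hx : (starRingEnd ℂ) x = x) :
    ∃ y : ℂ, (starRingEnd ℂ) y = y ∧ y ^ 3 = x := by
  obtain ⟨t, rfl⟩ := Complex.conj_eq_iff_real.1 hx
  have key : ∀ {t : ℝ}, 0 ≤ t → ∃ s : ℝ, s ^ 3 = t := fun {t} ht =>
    ⟨t ^ ((3 : ℕ) : ℝ)⁻¹, Real.rpow_inv_natCast_pow ht (by norm_num)⟩
  obtain ⟨s, hs⟩ : ∃ s : ℝ, s ^ 3 = t := by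
    rcases le_total 0 t with ht | ht
    · exact key ht
    · obtain ⟨s, hs⟩ := key (neg_nonneg.2 ht)
      exact ⟨-s, by linear_combination -hs⟩
  exact ⟨s, Complex.conj_ofReal s, by rw [← hs]; push_cast; rfl⟩

/-- An element of `K₁` which is a cube in `L₁ = K₁(ζ₃)` is a cube in `K₁`. -/
lemma exists_cube_root_mem_K1 (hd : ¬ 3 ∣ d) {x y : ℂ} (hx : x ∈ K1 d) (hy : y ∈ L1 d)
    (hxy : y ^ 3 = x) : ∃ z ∈ K1 d, z ^ 3 = x := by
  -- The real cube root differs from `y` by a power of ω ∈ L₁, so it is a real element of L₁, and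
  -- the real elements of L₁ form K₁.
  obtain ⟨z, hz, hzx⟩ := exists_real_cube_root (conj_of_mem_K1 d hx)
  refine ⟨z, mem_K1_of_conj_eq ?_ hz, hzx⟩
  have hr : rF d ∈ L1 d := F0_le_L1 d (rF_mem_F0 d)
  have hq : qK d ∈ L1 d := K1_le_L1 d (qK_mem_K1 d)
  have hω : omega d (rF d) (qK d) ∈ L1 d := by
    rw [omega]
    exact div_mem (add_mem (neg_mem (one_mem _)) (div_mem (mul_mem hr hq) (_root_.natCast_mem _ d)))
      (ofNat_mem _ 2)
  by_cases h0 : y = 0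
  · have : z = 0 := by
      rw [h0] at hxy
      rw [← hxy] at hzx
      simpa using hzx
    rw [this]
    exact zero_mem _
  · obtain ⟨w, rfl⟩ := exists_pow_val_of_pow_three_eq
      (omega_primitive (ne_zero_of_not_three_dvd hd) (rF_sq d) (qK_sq d)) h0 (hzx.trans hxy.symm)
    exact mul_mem (pow_mem hω _) hy

end Fields

/-! ### When a lift of an automorphism of order three has order three on cube roots -/

section CyclicAction

variable {F K : Type*} [Field F] [Field K] [Algebra F K]

lemma aut_pow_three_apply (s : K ≃ₐ[F] K) (x : K) : (s ^ 3) x = s (s (s x)) := by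
  rw [pow_succ, pow_two, AlgEquiv.mul_apply, AlgEquiv.mul_apply]

/-- Comparing cubes gives T x = ξ x u'/y with ξ³ = 1. Iterating, T³ x = ξ³ x · (u u' u'')/y³ = x:
the norm being the cube of a `T`-fixed `y` is exactly what is needed. -/
lemma iterate_three_cube_root_quotient (T : K ≃ₐ[F] K) {z : K} (hz : IsPrimitiveRoot z 3)
    (hTz : T z = z) {x y : K} (hx : x ≠ 0) (hy : y ≠ 0) (hTy : T y = y) {u u' u'' : K}
    (hu' : u' ≠ 0) (hu'' : u'' ≠ 0) (h1 : T u = u') (h2 : T u' = u'')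
    (h3 : T u'' = u) (hN : u * u' * u'' = y ^ 3) (hxu : x ^ 3 * u' = u) :
    (∃ w : ZMod 3, T x = z ^ w.val * (x * y⁻¹ * u')) ∧ T (T (T x)) = x := by
  have h : (T x) ^ 3 = (x * y⁻¹ * u') ^ 3 := by
    have hT := congrArg T hxu
    rw [map_mul, map_pow, h2, h1] at hT
    have : (x * y⁻¹ * u') ^ 3 * u'' = u' := by
      field_simp
      rw [← hN]
      linear_combination u' * u'' * hxu
    exact mul_right_cancel₀ hu'' (hT.trans this.symm)
  obtain ⟨w, hw⟩ := exists_pow_val_of_pow_three_eq hz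
    (mul_ne_zero (mul_ne_zero hx (inv_ne_zero hy)) hu') h
  have hw3 : (z ^ w.val) ^ 3 = 1 := by rw [← pow_mul, mul_comm, pow_mul, hz.pow_eq_one, one_pow]
  refine ⟨⟨w, hw⟩, ?_⟩
  have hTw : T (z ^ w.val) = z ^ w.val := by rw [map_pow, hTz]
  generalize z ^ w.val = ξ at *
  simp only [hw, map_mul, map_inv₀, hTw, hTy, h2, h3]
  field_simp
  linear_combination y ^ 3 * hw3 + ξ ^ 3 * hN

/-- Here T x' = η x'/x with η³ = 1, so T³ x' = x'/(x · T x · T² x). By the formula for T x this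
denominator is x³ u'² u''/y³ = 1. -/
lemma iterate_three_cube_root (T : K ≃ₐ[F] K) {z : K} (hz : IsPrimitiveRoot z 3)
    (hTz : T z = z) {x y x' : K} (hx : x ≠ 0) (hx' : x' ≠ 0) (hy : y ≠ 0) (hTy : T y = y)
    {u u' u'' : K} (hu' : u' ≠ 0) (hu'' : u'' ≠ 0) (h1 : T u = u') (h2 : T u' = u'')
    (h3 : T u'' = u) (hN : u * u' * u'' = y ^ 3) (hxu : x ^ 3 * u' = u) (hxu' : x' ^ 3 = u) :
    T (T (T x')) = x' := by
  obtain ⟨⟨w, hw⟩, -⟩ := iterate_three_cube_root_quotient T hz hTz hx hy hTy hu' hu'' h1 h2 h3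
    hN hxu
  have h : (T x') ^ 3 = (x' * x⁻¹) ^ 3 := by
    rw [← map_pow, hxu', h1, mul_pow, hxu', inv_pow]
    field_simp
    linear_combination hxu
  obtain ⟨v, hv⟩ := exists_pow_val_of_pow_three_eq hz (mul_ne_zero hx' (inv_ne_zero hx)) h
  have hw3 : (z ^ w.val) ^ 3 = 1 := by rw [← pow_mul, mul_comm, pow_mul, hz.pow_eq_one, one_pow]
  have hv3 : (z ^ v.val) ^ 3 = 1 := by rw [← pow_mul, mul_comm, pow_mul, hz.pow_eq_one, one_pow]
  have hTw : T (z ^ w.val) = z ^ w.val := by rw [map_pow, hTz]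
  have hTv : T (z ^ v.val) = z ^ v.val := by rw [map_pow, hTz]
  have hz0 : z ^ w.val ≠ 0 := pow_ne_zero _ (hz.ne_zero (by norm_num))
  generalize z ^ w.val = ξ at *
  generalize z ^ v.val = η at *
  simp only [hv, hw, map_mul, map_inv₀, hTw, hTv, hTy, h2]
  field_simp
  linear_combination y ^ 3 * hv3 - x ^ 3 * u' ^ 2 * u'' * hw3 - hN - u' * u'' * hxu

end CyclicAction

/-! ### The field H̃ᵢ, and Galois stability of the Kummer radicals -/

section CubeField

attribute [local instance] ratAlgebra ratModule

variable {d : ℕ}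

/-- The field generated over `L₁` by the cube roots of the first `i` of three elements of `K₁`. -/
noncomputable def cubeField (e : Fin 3 → K1 d) (i : ℕ) : IntermediateField ℚ ℂ :=
  L1 d ⊔ adjoin ℚ {x : ℂ | ∃ j : Fin 3, (j : ℕ) < i ∧ x ^ 3 = e j}

/-- Three elements of `K₁`, independent modulo cubes, on which `g` and `τ` act
(modulo cubes) as on a system of special units. -/
structure SpecialTriple (g τ : K1 d ≃ₐ[ℚ] K1 d) (e : Fin 3 → K1 d) : Prop where
  ne_zero : ∀ j, e j ≠ 0
  indep : ∀ c : Fin 3 → ZMod 3, ∀ v : K1 d, v ^ 3 = ∏ j, e j ^ (c j).val → c = 0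
  map_g : ∀ j, ∃ v, g (e j) = (e j)⁻¹ * v ^ 3
  map_zero : τ (e 0) = e 0
  map_two : e 1 * τ (e 2) = e 2
  norm : ∃ n : ℕ, e 2 * τ (e 2) * τ (τ (e 2)) = e 0 ^ n

lemma cubeField_eq (e : Fin 3 → K1 d) (i : ℕ) : cubeField e i =
    adjoin ℚ ({rF d, qK d, bB} ∪ {x : ℂ | ∃ j : Fin 3, (j : ℕ) < i ∧ x ^ 3 = e j}) := by
  rw [cubeField, L1_eq, ← adjoin_union]

lemma L1_le_cubeField (e : Fin 3 → K1 d) (i : ℕ) : L1 d ≤ cubeField e i := le_sup_left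

lemma K1_le_cubeField (e : Fin 3 → K1 d) (i : ℕ) : K1 d ≤ cubeField e i :=
  (K1_le_L1 d).trans (L1_le_cubeField e i)

lemma mem_cubeField {e : Fin 3 → K1 d} {i : ℕ} {j : Fin 3} (hj : (j : ℕ) < i) {x : ℂ}
    (hx : x ^ 3 = e j) : x ∈ cubeField e i :=
  (le_sup_right : _ ≤ cubeField e i) (subset_adjoin ℚ _ ⟨j, hj, hx⟩)

lemma finiteDimensional_cubeField (hd : ¬ 3 ∣ d) (e : Fin 3 → K1 d) (i : ℕ) :
    FiniteDimensional ℚ (cubeField e i) := by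
  have := finiteDimensional_L1 hd
  have := finiteDimensional_K1 hd
  have hfin : {x : ℂ | ∃ j : Fin 3, (j : ℕ) < i ∧ x ^ 3 = e j}.Finite := by
    refine (Set.finite_iUnion fun j : Fin 3 => (nthRoots 3 (e j : ℂ)).toFinset.finite_toSet).subset ?_
    rintro x ⟨j, -, hx⟩
    exact Set.mem_iUnion.2 ⟨j, by simpa [mem_nthRoots] using hx⟩
  have : Finite {x : ℂ | ∃ j : Fin 3, (j : ℕ) < i ∧ x ^ 3 = e j} := hfin
  have : FiniteDimensional ℚ
      (adjoin ℚ {x : ℂ | ∃ j : Fin 3, (j : ℕ) < i ∧ x ^ 3 = e j}) := by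
    apply finiteDimensional_adjoin
    rintro x ⟨j, -, hx⟩
    have h : IsIntegral ℚ (e j : ℂ) := (Algebra.IsIntegral.isIntegral (R := ℚ) (e j)).map (K1 d).val
    exact IsIntegral.of_pow (by norm_num : 0 < 3) (hx ▸ h)
  exact finiteDimensional_sup _ _

/-- The multiplicative monoid generated by all cubes and the first `i` of three elements. -/
noncomputable def cubeMonoid (e : Fin 3 → K1 d) (i : ℕ) : Submonoid (K1 d) :=
  Submonoid.closure ({u | ∃ v, u = v ^ 3} ∪ {u | ∃ j : Fin 3, (j : ℕ) < i ∧ u = e j})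

lemma pow_three_mem_cubeMonoid (e : Fin 3 → K1 d) (i : ℕ) (v : K1 d) : v ^ 3 ∈ cubeMonoid e i :=
  Submonoid.subset_closure (Or.inl ⟨v, rfl⟩)

lemma mem_cubeMonoid (e : Fin 3 → K1 d) {i : ℕ} {j : Fin 3} (hj : (j : ℕ) < i) :
    e j ∈ cubeMonoid e i :=
  Submonoid.subset_closure (Or.inr ⟨j, hj, rfl⟩)

lemma inv_mem_cubeMonoid {e : Fin 3 → K1 d} {i : ℕ} {u : K1 d} (hu : u ∈ cubeMonoid e i) :
    u⁻¹ ∈ cubeMonoid e i := by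
  by_cases h : u = 0
  · rw [h] at hu ⊢
    rwa [inv_zero]
  · have : u⁻¹ = u ^ 2 * u⁻¹ ^ 3 := by field_simp
    rw [this]
    exact mul_mem (pow_mem hu 2) (pow_three_mem_cubeMonoid e i _)

lemma map_mem_cubeMonoid {e : Fin 3 → K1 d} {i : ℕ} {t : K1 d ≃ₐ[ℚ] K1 d}
    (h : ∀ j : Fin 3, (j : ℕ) < i → t (e j) ∈ cubeMonoid e i) {u : K1 d}
    (hu : u ∈ cubeMonoid e i) : t u ∈ cubeMonoid e i := by
  have hle : cubeMonoid e i ≤ (cubeMonoid e i).comap (t : K1 d →* K1 d) := by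
    rw [cubeMonoid, Submonoid.closure_le, ← cubeMonoid]
    rintro x (⟨v, rfl⟩ | ⟨j, hj, rfl⟩)
    · change t (v ^ 3) ∈ cubeMonoid e i
      rw [map_pow]
      exact pow_three_mem_cubeMonoid e i _
    · exact h j hj
  exact hle hu

variable {g τ : K1 d ≃ₐ[ℚ] K1 d} {e : Fin 3 → K1 d}

namespace SpecialTriple

lemma g_mem_cubeMonoid (D : SpecialTriple g τ e) {i : ℕ} {j : Fin 3} (hj : (j : ℕ) < i) :
    g (e j) ∈ cubeMonoid e i := by
  obtain ⟨v, hv⟩ := D.map_g j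
  rw [hv]
  exact mul_mem (inv_mem_cubeMonoid (mem_cubeMonoid e hj)) (pow_three_mem_cubeMonoid e i v)

/-- Modulo cubes `τ` is unipotent along the flag e₀, e₁, e₂: it fixes e₀, sends e₁ to e₁/e₀ⁿ (by the
norm relation) and e₂ to e₂/e₁. So each initial segment is stable. -/
lemma τ_mem_cubeMonoid (D : SpecialTriple g τ e) {i : ℕ} {j : Fin 3} (hj : (j : ℕ) < i) :
    τ (e j) ∈ cubeMonoid e i := by
  obtain ⟨n, hn⟩ := D.norm
  have h2 : τ (e 2) ≠ 0 := (map_ne_zero τ).2 (D.ne_zero 2)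
  have h0 : e 0 ^ n ≠ 0 := pow_ne_zero _ (D.ne_zero 0)
  have h1 := D.map_two
  fin_cases j
  · change τ (e 0) ∈ _
    rw [D.map_zero]
    exact mem_cubeMonoid e hj
  · have hj0 : ((0 : Fin 3) : ℕ) < i := lt_of_le_of_lt (Nat.zero_le _) hj
    have : τ (e 1) = e 1 * (e 0 ^ n)⁻¹ * τ (e 2) ^ 3 := by
      have h1' := congrArg τ h1
      rw [map_mul] at h1'
      have h22 : τ (τ (e 2)) ≠ 0 := (map_ne_zero τ).2 h2
      apply mul_right_cancel₀ h22
      rw [h1']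
      field_simp
      rw [← hn]
      linear_combination -τ (e 2) * τ (τ (e 2)) * h1
    change τ (e 1) ∈ _
    rw [this]
    exact mul_mem (mul_mem (mem_cubeMonoid e hj) (inv_mem_cubeMonoid
      (pow_mem (mem_cubeMonoid e hj0) n))) (pow_three_mem_cubeMonoid e i _)
  · have hj1 : ((1 : Fin 3) : ℕ) < i := lt_of_le_of_lt (by decide : 1 ≤ 2) hj
    have : τ (e 2) = e 2 * (e 1)⁻¹ := by
      have := D.ne_zero 1
      field_simp
      linear_combination h1
    change τ (e 2) ∈ _
    rw [this]
    exact mul_mem (mem_cubeMonoid e hj) (inv_mem_cubeMonoid (mem_cubeMonoid e hj1))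

lemma aut_mem_cubeMonoid (D : SpecialTriple g τ e) (hd : ¬ 3 ∣ d)
    (hgen : Subgroup.closure {g, τ} = ⊤) (i : ℕ) (t : K1 d ≃ₐ[ℚ] K1 d) :
    ∀ u ∈ cubeMonoid e i, t u ∈ cubeMonoid e i := by
  have := finiteDimensional_K1 hd
  have ht : t ∈ Subgroup.closure {g, τ} := hgen ▸ Subgroup.mem_top t
  induction ht using Subgroup.closure_induction with
  | mem x hx =>
    rcases hx with rfl | rfl
    · exact fun u hu => map_mem_cubeMonoid (fun j hj => D.g_mem_cubeMonoid hj) hu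
    · exact fun u hu => map_mem_cubeMonoid (fun j hj => D.τ_mem_cubeMonoid hj) hu
  | one => exact fun u hu => hu
  | mul x y _ _ hx hy => exact fun u hu => hx _ (hy u hu)
  | inv x _ hx =>
    have hpow : ∀ n : ℕ, ∀ u ∈ cubeMonoid e i, (x ^ n) u ∈ cubeMonoid e i := by
      intro n
      induction n with
      | zero => exact fun u hu => hu
      | succ n ih =>
        intro u hu
        rw [pow_succ, AlgEquiv.mul_apply]
        exact ih _ (hx u hu)
    -- The automorphism group is finite, so an inverse is a natural power.
    obtain ⟨n, hn⟩ := mem_powers_iff_mem_zpowers.2 (Subgroup.inv_mem _ (Subgroup.mem_zpowers x))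
    rw [← hn]
    exact hpow n

end SpecialTriple

/-- The element `√-d` of the field generated by cube roots. -/
noncomputable def rE (e : Fin 3 → K1 d) (i : ℕ) : cubeField e i :=
  ⟨rF d, L1_le_cubeField e i (F0_le_L1 d (rF_mem_F0 d))⟩

/-- The element `√(3d)` of the field generated by cube roots. -/
noncomputable def qE (e : Fin 3 → K1 d) (i : ℕ) : cubeField e i :=
  ⟨qK d, K1_le_cubeField e i (qK_mem_K1 d)⟩

/-- The element `ζ₉ + ζ₉⁻¹` of the field generated by cube roots. -/
noncomputable def bE (e : Fin 3 → K1 d) (i : ℕ) : cubeField e i :=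
  ⟨bB, K1_le_cubeField e i (bB_mem_K1 d)⟩

/-- The inclusion of `K₁`. -/
noncomputable def inclE (e : Fin 3 → K1 d) (i : ℕ) : K1 d →ₐ[ℚ] cubeField e i :=
  inclusion (K1_le_cubeField e i)

lemma coe_rE (e : Fin 3 → K1 d) (i : ℕ) : (rE e i : ℂ) = rF d := rfl

lemma coe_bE (e : Fin 3 → K1 d) (i : ℕ) : (bE e i : ℂ) = bB := rfl

lemma coe_inclE (e : Fin 3 → K1 d) (i : ℕ) (x : K1 d) : (inclE e i x : ℂ) = x :=
  coe_inclusion (K1_le_cubeField e i) x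

lemma omegaE_primitive (hd : ¬ 3 ∣ d) (e : Fin 3 → K1 d) (i : ℕ) :
    IsPrimitiveRoot (omega d (rE e i) (qE e i)) 3 := by
  refine omega_primitive (ne_zero_of_not_three_dvd hd) (Subtype.ext ?_) (Subtype.ext ?_)
  · push_cast; exact rF_sq d
  · push_cast; exact qK_sq d

lemma exists_cube_root_of_mem_cubeMonoid {i : ℕ} {u : K1 d} (hu : u ∈ cubeMonoid e i) :
    ∃ y : cubeField e i, y ^ 3 = inclE e i u := by
  induction hu using Submonoid.closure_induction with
  | mem x hx =>
    rcases hx with ⟨v, rfl⟩ | ⟨j, hj, rfl⟩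
    · exact ⟨inclE e i v, (map_pow _ _ _).symm⟩
    · obtain ⟨y, hy⟩ := IsAlgClosed.exists_pow_nat_eq (e j : ℂ) (show 0 < 3 by norm_num)
      exact ⟨⟨y, mem_cubeField hj hy⟩, Subtype.ext (by rw [coe_inclE, ← hy]; push_cast; rfl)⟩
  | one => exact ⟨1, by simp⟩
  | mul x y _ _ hx hy =>
    obtain ⟨a, ha⟩ := hx
    obtain ⟨b, hb⟩ := hy
    exact ⟨a * b, by rw [mul_pow, ha, hb, map_mul]⟩

end CubeField

/-! ### Normality of H̃ᵢ over ℚ, and automorphisms given on generators -/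

section CubeField

attribute [local instance] ratAlgebra ratModule

variable {d : ℕ} {g τ : K1 d ≃ₐ[ℚ] K1 d} {e : Fin 3 → K1 d}

/-- A conjugate of a cube root of `e j` is a cube root of some `t (e j)`. Stability of the radicals
under all of Gal(K₁/ℚ) puts one such root in the field, and ω supplies the others. -/
lemma normal_cubeField (hd : ¬ 3 ∣ d) (D : SpecialTriple g τ e)
    (hgen : Subgroup.closure {g, τ} = ⊤) (i : ℕ) : Normal ℚ (cubeField e i) := by
  have := finiteDimensional_cubeField hd e i
  have := normal_K1 hd
  refine normal_of_generators (cubeField_eq e i) fun φ x hx => ?_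
  rcases hx with (hx | hx | hx) | ⟨j, hj, hx⟩
  · rcases map_rF φ hx with h | h <;> rw [h]
    · exact (rE e i).2
    · exact neg_mem (rE e i).2
  · rcases map_qK φ hx with h | h <;> rw [h]
    · exact (qE e i).2
    · exact neg_mem (qE e i).2
  · exact map_bB_mem φ (bE e i).2 hx
  · obtain ⟨t, ht⟩ := exists_restrict (K1_le_cubeField e i) φ
    obtain ⟨y, hy⟩ := exists_cube_root_of_mem_cubeMonoid
      (D.aut_mem_cubeMonoid hd hgen i t _ (mem_cubeMonoid e hj))
    have hφ : (φ x) ^ 3 = (y : ℂ) ^ 3 := by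
      have h1 : x ^ 3 = inclE e i (e j) := Subtype.ext (by rw [coe_inclE, ← hx]; push_cast; rfl)
      have h2 := congrArg (Subtype.val) hy
      rw [← map_pow, h1]
      push_cast at h2
      rw [h2, coe_inclE, ht]
      rfl
    have hy0 : (y : ℂ) ≠ 0 := by
      intro h0
      have hy0 : y = 0 := Subtype.ext h0
      rw [hy0] at hy
      have h3 : inclE e i (t (e j)) = 0 := by rw [← hy]; simp
      exact D.ne_zero j (by simpa using h3)
    have hω := (omegaE_primitive hd e i).map_of_injective (f := (cubeField e i).val)
      (cubeField e i).val.injective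
    obtain ⟨w, hw⟩ := exists_pow_val_of_pow_three_eq hω hy0 hφ
    rw [hw]
    exact mul_mem (pow_mem (Subtype.prop _) _) y.2

lemma algHom_ext_generators {S : Set ℂ} {k : IntermediateField ℚ ℂ} (hk : k = adjoin ℚ S)
    {Ω : Type*} [Field Ω] [Algebra ℚ Ω] {φ ψ : k →ₐ[ℚ] Ω}
    (h : ∀ x : k, (x : ℂ) ∈ S → φ x = ψ x) : φ = ψ :=
  algHom_ext_of_eq_adjoin ℚ hk fun x hx => h ⟨x, _⟩ hx

section Automorphisms

variable {i : ℕ} (s : cubeField e i ≃ₐ[ℚ] cubeField e i)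

lemma map_rE : s (rE e i) = rE e i ∨ s (rE e i) = -rE e i := by
  rcases map_rF ((cubeField e i).val.comp s.toAlgHom) (x := rE e i) rfl with h | h
  · exact Or.inl (Subtype.ext h)
  · exact Or.inr (Subtype.ext h)

lemma map_qE : s (qE e i) = qE e i ∨ s (qE e i) = -qE e i := by
  rcases map_qK ((cubeField e i).val.comp s.toAlgHom) (x := qE e i) rfl with h | h
  · exact Or.inl (Subtype.ext h)
  · exact Or.inr (Subtype.ext h)

lemma map_bE : s (bE e i) = bE e i ∨ s (bE e i) = bE e i ^ 2 - 2 ∨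
    s (bE e i) = 2 - bE e i - bE e i ^ 2 := by
  rcases map_bB ((cubeField e i).val.comp s.toAlgHom) (x := bE e i) rfl with h | h | h
  · exact Or.inl (Subtype.ext h)
  · exact Or.inr (Or.inl (Subtype.ext h))
  · exact Or.inr (Or.inr (Subtype.ext h))

lemma map_omega {k : Type*} [Field k] (t : k ≃+* k) (r q : k) :
    t (omega d r q) = omega d (t r) (t q) := by
  simp only [omega, map_div₀, map_add, map_neg, map_one, map_mul, map_natCast, map_ofNat]

lemma map_inclE {s : cubeField e i ≃ₐ[ℚ] cubeField e i} {t : K1 d ≃ₐ[ℚ] K1 d}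
    (hq : s (qE e i) = inclE e i (t ⟨qK d, qK_mem_K1 d⟩))
    (hb : s (bE e i) = inclE e i (t ⟨bB, bB_mem_K1 d⟩)) (x : K1 d) :
    s (inclE e i x) = inclE e i (t x) := by
  have h : (s.toAlgHom).comp (inclE e i) = (inclE e i).comp t.toAlgHom := by
    refine algHom_ext_generators (K1_eq d) ?_
    rintro ⟨x, hx⟩ (rfl | rfl)
    · exact hq
    · exact hb
  exact DFunLike.congr_fun h x

lemma map_of_mem_L1 {s : cubeField e i ≃ₐ[ℚ] cubeField e i} (hr : s (rE e i) = rE e i)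
    (hq : s (qE e i) = qE e i) (hb : s (bE e i) = bE e i) (x : cubeField e i)
    (hx : (x : ℂ) ∈ L1 d) : s x = x := by
  have h : (s.toAlgHom).comp (inclusion (L1_le_cubeField e i)) =
      inclusion (L1_le_cubeField e i) := by
    refine algHom_ext_generators (L1_eq d) ?_
    rintro ⟨x, hx⟩ (rfl | rfl | rfl)
    · exact hr
    · exact hq
    · exact hb
  exact DFunLike.congr_fun h ⟨x, hx⟩

end Automorphisms

lemma exists_conj_aut (K : IntermediateField ℚ ℂ) [Normal ℚ K] :
    ∃ c : K ≃ₐ[ℚ] K, ∀ x : K, (c x : ℂ) = (starRingEnd ℂ) x :=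
  exists_restrict (le_refl K) ((Complex.conjAe.toAlgHom.restrictScalars ℚ).comp K.val)

/-- An extension of `t` that negates √-d is corrected by complex conjugation, which negates √-d and
is trivial on the real field K₁. -/
lemma exists_extend_fixing {i : ℕ} [Normal ℚ (cubeField e i)]
    (t : K1 d ≃ₐ[ℚ] K1 d) : ∃ s : cubeField e i ≃ₐ[ℚ] cubeField e i,
      s (rE e i) = rE e i ∧ ∀ x, s (inclE e i x) = inclE e i (t x) := by
  obtain ⟨s, hs⟩ : ∃ s : cubeField e i ≃ₐ[ℚ] cubeField e i,
      ∀ x, s (inclE e i x) = inclE e i (t x) := exists_extend (K1_le_cubeField e i) t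
  rcases map_rE s with h | h
  · exact ⟨s, h, hs⟩
  · obtain ⟨c, hc⟩ := exists_conj_aut (cubeField e i)
    have hcr : c (rE e i) = -rE e i := by
      apply Subtype.ext
      rw [hc, IntermediateField.coe_neg, coe_rE, conj_rF]
    have hcx : ∀ x, c (inclE e i x) = inclE e i x := fun x => by
      apply Subtype.ext
      rw [hc, coe_inclE, conj_of_mem_K1 d x.2]
    refine ⟨s * c, ?_, fun x => ?_⟩
    · rw [AlgEquiv.mul_apply, hcr, map_neg, h, neg_neg]
    · rw [AlgEquiv.mul_apply, hcx, hs]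

end CubeField

/-! ### Kummer theory of H̃ᵢ/L₁ and the lift of τ -/

section Tower

attribute [local instance] ratAlgebra ratModule

variable {d : ℕ} {g τ : K1 d ≃ₐ[ℚ] K1 d} {e : Fin 3 → K1 d} {i : ℕ}

/-- The generator `√(3d)` of `K₀`, as an element of `K₁`. -/
noncomputable def q1 (d : ℕ) : K1 d := ⟨qK d, qK_mem_K1 d⟩

/-- The generator `ζ₉ + ζ₉⁻¹` of `B₁`, as an element of `K₁`. -/
noncomputable def b1 (d : ℕ) : K1 d := ⟨bB, bB_mem_K1 d⟩

lemma inclE_q1 (e : Fin 3 → K1 d) (i : ℕ) : inclE e i (q1 d) = qE e i :=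
  Subtype.ext (coe_inclE e i (q1 d))

lemma inclE_b1 (e : Fin 3 → K1 d) (i : ℕ) : inclE e i (b1 d) = bE e i :=
  Subtype.ext (coe_inclE e i (b1 d))

/-- A cube root of `e j`. -/
noncomputable def rootE (e : Fin 3 → K1 d) (i : ℕ) (j : {j : Fin 3 // (j : ℕ) < i}) :
    cubeField e i :=
  (exists_cube_root_of_mem_cubeMonoid (mem_cubeMonoid e j.2)).choose

lemma rootE_pow (e : Fin 3 → K1 d) (i : ℕ) (j : {j : Fin 3 // (j : ℕ) < i}) :
    rootE e i j ^ 3 = inclE e i (e j) :=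
  (exists_cube_root_of_mem_cubeMonoid (mem_cubeMonoid e j.2)).choose_spec

lemma rootE_ne_zero (D : SpecialTriple g τ e) (j : {j : Fin 3 // (j : ℕ) < i}) :
    rootE e i j ≠ 0 := by
  intro h
  have h3 := rootE_pow e i j
  rw [h] at h3
  rw [zero_pow (by norm_num)] at h3
  exact D.ne_zero j ((map_eq_zero (inclE e i)).1 h3.symm)

lemma inclE_fixed {s : cubeField e i ≃ₐ[ℚ] cubeField e i} (hq : s (qE e i) = qE e i)
    (hb : s (bE e i) = bE e i) (x : K1 d) : s (inclE e i x) = inclE e i x :=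
  map_inclE (t := 1) (hq.trans (inclE_q1 e i).symm) (hb.trans (inclE_b1 e i).symm) x

/-- An automorphism fixing √-d and ζ₉ + ζ₉⁻¹ and negating √(3d) restricts to `g` on K₁. From g(eⱼ) =
eⱼ⁻¹v³ it sends αⱼ to αⱼ⁻¹v times a cube root of unity, and that factor, like v, is fixed over L₁.
-/
lemma invertedKummerTower (hd : ¬ 3 ∣ d) (D : SpecialTriple g τ e) (hgq : g (q1 d) = -q1 d)
    (hgb : g (b1 d) = b1 d) [Normal ℚ (cubeField e i)] :
    InvertedKummerTower ℚ (rE e i) (qE e i) (bE e i) (omega d (rE e i) (qE e i))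
      (rootE e i) := by
  have hz := omegaE_primitive hd e i
  have hd0 := ne_zero_of_not_three_dvd hd
  have hfix : ∀ s : cubeField e i ≃ₐ[ℚ] cubeField e i, s (rE e i) = rE e i →
      s (qE e i) = qE e i → s (omega d (rE e i) (qE e i)) = omega d (rE e i) (qE e i) := by
    intro s hr hq
    have := map_omega (d := d) (s : cubeField e i ≃+* cubeField e i) (rE e i) (qE e i)
    refine this.trans ?_
    change omega d (s (rE e i)) (s (qE e i)) = _
    rw [hr, hq]
  have hr2 : rE e i ^ 2 = -(d : cubeField e i) := Subtype.ext (by push_cast; exact rF_sq d)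
  have hq2 : qE e i ^ 2 = 3 * (d : cubeField e i) := Subtype.ext (by push_cast; exact qK_sq d)
  refine ⟨hz, map_qE, ?_, hfix, ?_, rootE_ne_zero D, ?_, ?_, ?_, ?_⟩
  · intro h
    apply qK_ne_zero hd
    have h2 : qE e i = 0 := by linear_combination h / 2
    have h3 := congrArg Subtype.val h2
    exact h3
  · intro s hr hq
    have := map_omega (d := d) (s : cubeField e i ≃+* cubeField e i) (rE e i) (qE e i)
    refine this.trans ?_
    change omega d (s (rE e i)) (s (qE e i)) = _
    rw [hr, hq, omega_neg hd0 hr2 hq2]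
  · intro s hr hq hb hα
    have hL := map_of_mem_L1 hr hq hb
    have h : s.toAlgHom = AlgHom.id ℚ (cubeField e i) := by
      refine algHom_ext_generators (cubeField_eq e i) fun x hx => ?_
      change s x = x
      rcases hx with (hx | hx | hx) | ⟨j, hj, hx⟩
      · rwa [show x = rE e i from Subtype.ext hx]
      · rwa [show x = qE e i from Subtype.ext hx]
      · rwa [show x = bE e i from Subtype.ext hx]
      · have hx3 : x ^ 3 = rootE e i ⟨j, hj⟩ ^ 3 := by
          rw [rootE_pow]
          apply Subtype.ext
          rw [coe_inclE, ← hx]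
          push_cast
          rfl
        obtain ⟨w, hw⟩ := exists_pow_val_of_pow_three_eq hz (rootE_ne_zero D ⟨j, hj⟩) hx3
        rw [hw, map_mul, map_pow, hfix s hr hq, hα]
    exact AlgEquiv.ext fun x => DFunLike.congr_fun h x
  · intro s hr hq hb j
    apply exists_pow_val_of_pow_three_eq hz (rootE_ne_zero D j)
    rw [← map_pow, rootE_pow, inclE_fixed hq hb]
  · intro s hr hq hb j
    have hs := map_inclE (s := s) (t := g)
      (show s (qE e i) = inclE e i (g (q1 d)) by rw [hq, hgq, map_neg, inclE_q1])
      (show s (bE e i) = inclE e i (g (b1 d)) by rw [hb, hgb, inclE_b1])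
    obtain ⟨v, hv⟩ := D.map_g j
    have hα := rootE_ne_zero D j
    have hv0 : v ≠ 0 := by
      rintro rfl
      have : g (e j) ≠ 0 := (map_ne_zero g).2 (D.ne_zero j)
      apply this
      rw [hv]
      simp
    have h3 : s (rootE e i j) ^ 3 = ((rootE e i j)⁻¹ * inclE e i v) ^ 3 := by
      rw [← map_pow, rootE_pow, hs, hv, map_mul, map_inv₀, map_pow, mul_pow, inv_pow, rootE_pow]
    obtain ⟨w, hw⟩ := exists_pow_val_of_pow_three_eq hz
      (mul_ne_zero (inv_ne_zero hα) ((map_ne_zero (inclE e i)).2 hv0)) h3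
    refine ⟨omega d (rE e i) (qE e i) ^ w.val * inclE e i v, ?_, ?_⟩
    · intro t htr htq htb
      rw [map_mul, map_pow, hfix t htr htq, inclE_fixed htq htb]
    · rw [hw]
      ring
  · obtain ⟨s, hsr, hs⟩ := exists_extend_fixing (i := i) (e := e) g
    refine ⟨s, hsr, ?_, ?_⟩
    · rw [← inclE_b1, hs, hgb]
    · rw [← inclE_q1, hs, hgq, map_neg]

/-- `Gal(K/L₁)`, for the field `K` generated by cube roots over `L₁`. -/
noncomputable def galL1 (e : Fin 3 → K1 d) (i : ℕ) : Subgroup (cubeField e i ≃ₐ[ℚ] cubeField e i) :=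
  IntermediateField.fixingSubgroup (restrict (L1_le_cubeField e i))

lemma mem_galL1 {s : cubeField e i ≃ₐ[ℚ] cubeField e i} :
    s ∈ galL1 e i ↔ s (rE e i) = rE e i ∧ s (qE e i) = qE e i ∧ s (bE e i) = bE e i := by
  rw [galL1, IntermediateField.mem_fixingSubgroup_iff]
  constructor
  · intro h
    exact ⟨h _ ((mem_restrict _ _).2 (F0_le_L1 d (rF_mem_F0 d))),
      h _ ((mem_restrict _ _).2 (K1_le_L1 d (qK_mem_K1 d))),
      h _ ((mem_restrict _ _).2 (K1_le_L1 d (bB_mem_K1 d)))⟩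
  · rintro ⟨hr, hq, hb⟩ x hx
    exact map_of_mem_L1 hr hq hb x ((mem_restrict _ _).1 hx)

/-- A product of roots fixed by Gal(H̃ᵢ/L₁) lies in L₁, so its cube, a product of the `e j`, is a
cube in L₁ and hence in K₁. Independence in K₁ applies once the exponents are extended by zero to
all three indices. -/
lemma SpecialTriple.indep_roots (hd : ¬ 3 ∣ d) (D : SpecialTriple g τ e)
    [FiniteDimensional ℚ (cubeField e i)] [IsGalois ℚ (cubeField e i)]
    (c : {j : Fin 3 // (j : ℕ) < i} → ZMod 3)
    (hc : ∀ s ∈ galL1 e i, s (∏ j, rootE e i j ^ (c j).val) = ∏ j, rootE e i j ^ (c j).val) :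
    c = 0 := by
  set y := ∏ j, rootE e i j ^ (c j).val with hy
  have hyL : (y : ℂ) ∈ L1 d := by
    rw [← mem_restrict (L1_le_cubeField e i),
      ← IsGalois.fixedField_fixingSubgroup (restrict (L1_le_cubeField e i)), mem_fixedField_iff]
    exact hc
  let c' : Fin 3 → ZMod 3 := fun j => if h : (j : ℕ) < i then c ⟨j, h⟩ else 0
  have hprod : ∏ j, e j ^ (c' j).val = ∏ j : {j : Fin 3 // (j : ℕ) < i}, e j ^ (c j).val := by
    rw [← Finset.prod_filter_mul_prod_filter_not Finset.univ (fun j : Fin 3 => (j : ℕ) < i),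
      Finset.prod_eq_one (s := Finset.univ.filter fun j : Fin 3 => ¬ (j : ℕ) < i), mul_one]
    · rw [Finset.prod_subtype (p := fun j : Fin 3 => (j : ℕ) < i) _ (by simp)]
      refine Finset.prod_congr rfl fun j _ => ?_
      simp only [c', dif_pos j.2]
    · intro j hj
      simp only [Finset.mem_filter] at hj
      simp only [c', dif_neg hj.2, ZMod.val_zero, pow_zero]
  have hy3 : y ^ 3 = inclE e i (∏ j, e j ^ (c' j).val) := by
    rw [hprod, hy, map_prod, ← Finset.prod_pow]
    refine Finset.prod_congr rfl fun j _ => ?_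
    rw [map_pow, ← rootE_pow, ← pow_mul, ← pow_mul, mul_comm]
  have hy3' := congrArg Subtype.val hy3
  rw [coe_inclE, IntermediateField.coe_pow] at hy3'
  obtain ⟨z, hz, hzy⟩ := exists_cube_root_mem_K1 hd (Subtype.prop _) hyL hy3'
  have h0 := D.indep c' ⟨z, hz⟩ (Subtype.ext (by rw [IntermediateField.coe_pow]; exact hzy))
  funext j
  exact (show c' j = c j from dif_pos j.2).symm.trans (congrFun h0 j)

lemma card_galL1 (hd : ¬ 3 ∣ d) (D : SpecialTriple g τ e) (hgq : g (q1 d) = -q1 d)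
    (hgb : g (b1 d) = b1 d) [FiniteDimensional ℚ (cubeField e i)] [IsGalois ℚ (cubeField e i)]
    (hi : i ≤ 3) : Nat.card (galL1 e i) = 3 ^ i := by
  have W := invertedKummerTower (i := i) hd D hgq hgb
  have h := natCard_kummer_group (A := galL1 e i) W.root
    (fun s hs => by obtain ⟨hr, hq, -⟩ := mem_galL1.1 hs; exact W.fix_root s hr hq) W.ne_zero
    (fun s hs => by obtain ⟨hr, hq, hb⟩ := mem_galL1.1 hs; exact W.kummer s hr hq hb)
    (D.indep_roots hd)
    (fun s hs => by obtain ⟨hr, hq, hb⟩ := mem_galL1.1 hs; exact W.faithful s hr hq hb)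
  have hcard : Fintype.card {j : Fin 3 // (j : ℕ) < i} = i := by
    rw [Fintype.card_subtype]
    interval_cases i <;> decide
  rw [h, hcard]

lemma card_galL1_mul_finrank [FiniteDimensional ℚ (cubeField e i)] [IsGalois ℚ (cubeField e i)] :
    Nat.card (galL1 e i) * Module.finrank ℚ (L1 d) = Module.finrank ℚ (cubeField e i) :=
  card_fixingSubgroup_restrict_mul_finrank (L1_le_cubeField e i)

lemma finrank_cubeField (hd : ¬ 3 ∣ d) (D : SpecialTriple g τ e) (hgq : g (q1 d) = -q1 d)
    (hgb : g (b1 d) = b1 d) [FiniteDimensional ℚ (cubeField e i)] [IsGalois ℚ (cubeField e i)]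
    (hi : i ≤ 3) : Module.finrank ℚ (cubeField e i) = 12 * 3 ^ i := by
  have h1 := card_galL1 hd D hgq hgb hi
  have h2 := finrank_L1 hd
  rw [← card_galL1_mul_finrank, h1, h2, mul_comm]

/-- `τ` lifts to an automorphism of order three. -/
lemma exists_lift_of_order_three (hd : ¬ 3 ∣ d) (D : SpecialTriple g τ e)
    (hgq : g (q1 d) = -q1 d) (hgb : g (b1 d) = b1 d) (hτq : τ (q1 d) = q1 d) (hτ : τ ^ 3 = 1)
    [FiniteDimensional ℚ (cubeField e i)] [IsGalois ℚ (cubeField e i)] (hi : 1 ≤ i) :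
    ∃ T : cubeField e i ≃ₐ[ℚ] cubeField e i, T (rE e i) = rE e i ∧
      (∀ x, T (inclE e i x) = inclE e i (τ x)) ∧ T ^ 3 = 1 := by
  have W := invertedKummerTower (i := i) hd D hgq hgb
  have hz := W.root
  obtain ⟨T₀, hr, hT₀⟩ := exists_extend_fixing (i := i) (e := e) τ
  let j₀ : {j : Fin 3 // (j : ℕ) < i} := ⟨0, hi⟩
  have h0 : T₀ (rootE e i j₀) ^ 3 = rootE e i j₀ ^ 3 := by
    rw [← map_pow, rootE_pow, hT₀]
    exact congrArg _ D.map_zero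
  obtain ⟨w, hw⟩ := exists_pow_val_of_pow_three_eq hz (W.ne_zero j₀) h0
  -- `k` cancels the factor ω^w by which `T₀` moves α₀; its effect on the other roots is immaterial,
  -- and the constant vector `-w` is merely convenient.
  obtain ⟨k, hk, hkα⟩ := exists_kummer_automorphism (A := galL1 e i) hz
    (fun s hs => by obtain ⟨hr, hq, -⟩ := mem_galL1.1 hs; exact W.fix_root s hr hq)
    (fun s hs => by obtain ⟨hr, hq, hb⟩ := mem_galL1.1 hs; exact W.kummer s hr hq hb)
    (D.indep_roots hd) (fun _ => -w)
  obtain ⟨hkr, hkq, hkb⟩ := mem_galL1.1 hk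
  obtain ⟨T, hT⟩ : ∃ T, T = k * T₀ := ⟨_, rfl⟩
  have hTr : T (rE e i) = rE e i := by rw [hT, AlgEquiv.mul_apply, hr, hkr]
  have hTx : ∀ x, T (inclE e i x) = inclE e i (τ x) := fun x => by
    rw [hT, AlgEquiv.mul_apply, hT₀, inclE_fixed hkq hkb]
  have hTα : T (rootE e i j₀) = rootE e i j₀ := by
    rw [hT, AlgEquiv.mul_apply, hw, map_mul, map_pow, W.fix_root k hkr hkq, hkα, ← mul_assoc,
      ← pow_val_add hz.pow_eq_one]
    simp
  have hTq : T (qE e i) = qE e i := by rw [← inclE_q1, hTx, hτq]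
  have hTz := W.fix_root T hTr hTq
  have hτ3 : ∀ x, τ (τ (τ x)) = x := fun x => by
    rw [← aut_pow_three_apply, hτ, AlgEquiv.one_apply]
  refine ⟨T, hTr, hTx, W.ext_aut ?_ ?_ ?_ fun j => ?_⟩
  · rw [aut_pow_three_apply, hTr, hTr, hTr, AlgEquiv.one_apply]
  · rw [aut_pow_three_apply, hTq, hTq, hTq, AlgEquiv.one_apply]
  · rw [← inclE_b1, aut_pow_three_apply, hTx, hTx, hTx, hτ3, AlgEquiv.one_apply]
  obtain ⟨n, hn⟩ := D.norm
  have hy : rootE e i j₀ ^ n ≠ 0 := pow_ne_zero _ (W.ne_zero j₀)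
  have hTy : T (rootE e i j₀ ^ n) = rootE e i j₀ ^ n := by rw [map_pow, hTα]
  have hu0 : ∀ {x : K1 d}, x ≠ 0 → inclE e i x ≠ 0 := fun hx => (_root_.map_ne_zero _).2 hx
  have hτ0 : ∀ {x : K1 d}, x ≠ 0 → τ x ≠ 0 := fun hx => (_root_.map_ne_zero _).2 hx
  -- The norm e₀ⁿ has become the cube of α₀ⁿ, which `T` fixes.
  have hN : inclE e i (e 2) * inclE e i (τ (e 2)) * inclE e i (τ (τ (e 2))) =
      (rootE e i j₀ ^ n) ^ 3 := by
    rw [← map_mul, ← map_mul, hn, map_pow, ← pow_mul, mul_comm, pow_mul, rootE_pow]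
  have hT3 : T (inclE e i (τ (τ (e 2)))) = inclE e i (e 2) := by rw [hTx, hτ3]
  have hroot1 : ∀ h1 : ((1 : Fin 3) : ℕ) < i,
      rootE e i ⟨1, h1⟩ ^ 3 * inclE e i (τ (e 2)) = inclE e i (e 2) := fun h1 => by
    rw [rootE_pow, ← map_mul, D.map_two]
  have key : T (T (T (rootE e i j))) = rootE e i j := by
    obtain ⟨j, hj⟩ := j
    fin_cases j
    · change T (T (T (rootE e i j₀))) = rootE e i j₀
      rw [hTα, hTα, hTα]
    · exact (iterate_three_cube_root_quotient T hz hTz (W.ne_zero ⟨1, hj⟩) hy hTy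
        (hu0 (hτ0 (D.ne_zero 2))) (hu0 (hτ0 (hτ0 (D.ne_zero 2)))) (hTx _) (hTx _) hT3 hN
        (hroot1 hj)).2
    · have h1 : ((1 : Fin 3) : ℕ) < i := lt_of_le_of_lt (by decide : 1 ≤ 2) hj
      exact iterate_three_cube_root T hz hTz (W.ne_zero ⟨1, h1⟩) (W.ne_zero ⟨2, hj⟩) hy hTy
        (hu0 (hτ0 (D.ne_zero 2))) (hu0 (hτ0 (hτ0 (D.ne_zero 2)))) (hTx _) (hTx _) hT3 hN
        (hroot1 h1) (rootE_pow e i ⟨2, hj⟩)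
  rw [aut_pow_three_apply, key, AlgEquiv.one_apply]

end Tower

/-! ### From subfields of H̃ᵢ to extensions of F₀ inside ℂ -/

section Descent

attribute [local instance] ratAlgebra ratModule

variable {d : ℕ} {g τ : K1 d ≃ₐ[ℚ] K1 d} {e : Fin 3 → K1 d} {i : ℕ}

lemma exists_descent_cubeField (hd : ¬ 3 ∣ d) (D : SpecialTriple g τ e) (hgq : g (q1 d) = -q1 d)
    (hgb : g (b1 d) = b1 d) (hτq : τ (q1 d) = q1 d) (hτb : τ (b1 d) ≠ b1 d) (hτ : τ ^ 3 = 1)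
    [FiniteDimensional ℚ (cubeField e i)] [IsGalois ℚ (cubeField e i)] (hi : 1 ≤ i) :
    ∃ γ : cubeField e i ≃ₐ[ℚ] cubeField e i,
      (∀ s : cubeField e i ≃ₐ[ℚ] cubeField e i,
        ((s (rE e i) = rE e i ∧ s (bE e i) = bE e i) ∧ orderOf s = 2) ↔ s = γ) ∧
      ∃ H : IntermediateField ℚ (cubeField e i), rE e i ∈ H ∧
        Module.finrank H (cubeField e i) = 6 ∧
        fixedField (Subgroup.zpowers γ) = adjoin ℚ {rE e i, bE e i} ⊔ H := by
  obtain ⟨T, hTr, hTx, hT⟩ := exists_lift_of_order_three hd D hgq hgb hτq hτ hi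
  refine (invertedKummerTower (i := i) hd D hgq hgb).exists_descent hTr ?_ hT ?_
  · rw [← inclE_b1, hTx]
    exact (inclE e i).injective.ne hτb
  · intro s hs
    rcases map_bE T with h | h | h <;> rw [h]
    · exact hs
    · rw [map_sub, map_pow, hs, map_ofNat]
    · rw [map_sub, map_sub, map_pow, hs, map_ofNat]

/-- The group `Gal(K/F₁)` has a unique element of order two, whose fixed field descends to an
extension of `F₀` of degree `3 ^ i`. -/
def DescendsInvolution (d i : ℕ) (K : IntermediateField ℚ ℂ) : Prop :=
  ∃ γ : K ≃ₐ[ℚ] K,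
    (∀ s : K ≃ₐ[ℚ] K, ((∀ x : K, (x : ℂ) ∈ F1 d → s x = x) ∧ orderOf s = 2) ↔ s = γ) ∧
    ∃ H' : IntermediateField (F0 d) ℂ, Module.finrank (F0 d) H' = 3 ^ i ∧
      lift (fixedField (Subgroup.zpowers γ)) = F1 d ⊔ H'.restrictScalars ℚ

lemma fixes_F1_iff {K : IntermediateField ℚ ℂ} {r b : K} (hr : (r : ℂ) = rF d)
    (hb : (b : ℂ) = bB) (s : K ≃ₐ[ℚ] K) :
    (∀ x : K, (x : ℂ) ∈ F1 d → s x = x) ↔ s r = r ∧ s b = b := by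
  have hrF : rF d ∈ F1 d := (le_sup_left : F0 d ≤ F1 d) (rF_mem_F0 d)
  have hbF : bB ∈ F1 d := (le_sup_right : B1 ≤ F1 d) bB_mem_B1
  have hle : F1 d ≤ K := by
    rw [F1_eq, adjoin_le_iff]
    rintro x (rfl | rfl)
    · exact hr ▸ r.2
    · exact hb ▸ b.2
  constructor
  · intro h
    exact ⟨h r (hr ▸ hrF), h b (hb ▸ hbF)⟩
  · rintro ⟨h1, h2⟩ x hx
    have h : (s.toAlgHom).comp (inclusion hle) = inclusion hle := by
      refine algHom_ext_generators (F1_eq d) ?_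
      rintro ⟨y, hy⟩ (rfl | rfl)
      · have : inclusion hle ⟨rF d, hy⟩ = r := Subtype.ext hr.symm
        change s (inclusion hle ⟨rF d, hy⟩) = inclusion hle ⟨rF d, hy⟩
        rw [this, h1]
      · have : inclusion hle ⟨bB, hy⟩ = b := Subtype.ext hb.symm
        change s (inclusion hle ⟨bB, hy⟩) = inclusion hle ⟨bB, hy⟩
        rw [this, h2]
    exact DFunLike.congr_fun h ⟨x, hx⟩

lemma finrank_lift_mul {F Ω : Type*} [Field F] [Field Ω] [Algebra F Ω]
    {K : IntermediateField F Ω} (H : IntermediateField F K) :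
    Module.finrank F (lift H) * Module.finrank H K = Module.finrank F K := by
  rw [← (liftAlgEquiv H).toLinearEquiv.finrank_eq, Module.finrank_mul_finrank]

lemma lift_adjoin_pair_sup {F Ω : Type*} [Field F] [Field Ω] [Algebra F Ω]
    {K : IntermediateField F Ω} (r b : K) (H : IntermediateField F K) :
    lift (adjoin F {r, b} ⊔ H) = adjoin F {(r : Ω), (b : Ω)} ⊔ lift H := by
  rw [lift_sup]
  congr 1
  rw [lift, adjoin_map, Set.image_pair]
  rfl

/-- The degree count: [K : ℚ] = 12·3^i and [K : H] = 6 give [H : ℚ] = 2·3^i, and F₀ ⊆ H has degree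
2. -/
lemma descendsInvolution_of_exists (hd : ¬ 3 ∣ d) {K : IntermediateField ℚ ℂ} {r b : K}
    (hr : (r : ℂ) = rF d) (hb : (b : ℂ) = bB) (hK : Module.finrank ℚ K = 12 * 3 ^ i)
    (h : ∃ γ : K ≃ₐ[ℚ] K, (∀ s : K ≃ₐ[ℚ] K, ((s r = r ∧ s b = b) ∧ orderOf s = 2) ↔ s = γ) ∧
      ∃ H : IntermediateField ℚ K, r ∈ H ∧ Module.finrank H K = 6 ∧
        fixedField (Subgroup.zpowers γ) = adjoin ℚ {r, b} ⊔ H) :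
    DescendsInvolution d i K := by
  obtain ⟨γ, hγ, H, hrH, h6, hfix⟩ := h
  refine ⟨γ, fun s => by rw [fixes_F1_iff hr hb s, hγ], ?_⟩
  have hle : F0 d ≤ lift H := by
    rw [F0, adjoin_simple_le_iff]
    change rF d ∈ lift H
    rw [← hr]
    exact (mem_lift r).2 hrH
  refine ⟨extendScalars hle, ?_, ?_⟩
  · have h1 := finrank_lift_mul H
    have h2 := finrank_bot_mul_relfinrank hle
    rw [relfinrank_eq_finrank_of_le hle, (finrank_F0 hd).2] at h2
    rw [h6, hK] at h1
    omega
  · rw [extendScalars_restrictScalars, hfix, lift_adjoin_pair_sup, hr, hb, F1_eq]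

end Descent

/-- An automorphism of a subfield of `ℂ`, considered for the algebra structure `ratAlgebra`. -/
noncomputable def toRat {K : IntermediateField ℚ ℂ} (s : K ≃ₐ[ℚ] K) :
    @AlgEquiv ℚ K K _ _ _ (ratAlgebra K) (ratAlgebra K) := s

/-- Passes from `ratAlgebra` to the ℚ-algebra structure used in the theorem; the two agree
definitionally. -/
lemma DescendsInvolution.exists_fixedFieldOf {d i : ℕ} {K : IntermediateField ℚ ℂ}
    (h : DescendsInvolution d i K) :
    ∃ γ : K ≃ₐ[ℚ] K, (∀ s : K ≃ₐ[ℚ] K, (Fixes s (F1 d) ∧ orderOf s = 2) ↔ s = γ) ∧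
      ∃ H' : IntermediateField (F0 d) ℂ, Module.finrank (F0 d) H' = 3 ^ i ∧
        fixedFieldOf γ = F1 d ⊔ H'.restrictScalars ℚ := h

section Conversion

variable {K k : IntermediateField ℚ ℂ} {s : K ≃ₐ[ℚ] K}

lemma GeneratesGal.fixes (hs : GeneratesGal s k) : Fixes s k := (hs s).1 (Subgroup.mem_zpowers s)

lemma GeneratesGal.toRat_iff (hs : GeneratesGal s k)
    (t : @AlgEquiv ℚ K K _ _ _ (ratAlgebra K) (ratAlgebra K)) :
    t ∈ Subgroup.zpowers (toRat s) ↔ ∀ x : K, (x : ℂ) ∈ k → t x = x := hs t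

end Conversion

/-! ### From special units to independent elements of K₁ -/

section Units

lemma coe_unitsMap {K L : Type*} [Field K] [Field L] (f : K →+* L) (u : (𝓞 K)ˣ) :
    (((unitsMap f u : (𝓞 L)ˣ) : 𝓞 L) : L) = f ((u : 𝓞 K) : K) := rfl

/-- The value of a unit of the ring of integers of `K₁`. -/
noncomputable def unitVal {d : ℕ} : E d →* K1 d :=
  (algebraMap (𝓞 (K1 d)) (K1 d) : 𝓞 (K1 d) →* K1 d).comp (Units.coeHom (𝓞 (K1 d)))

lemma unitVal_apply {d : ℕ} (u : E d) : unitVal u = ((u : 𝓞 (K1 d)) : K1 d) := rfl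

lemma unitVal_ne_zero {d : ℕ} (u : E d) : unitVal u ≠ 0 := by
  have h : unitVal u * unitVal u⁻¹ = 1 := by rw [← map_mul, mul_inv_cancel, map_one]
  exact left_ne_zero_of_mul_eq_one h

lemma unitVal_act {d : ℕ} (s : K1 d ≃ₐ[ℚ] K1 d) (u : E d) :
    unitVal (act s u) = toRat s (unitVal u) :=
  coe_unitsMap (s : K1 d →+* K1 d) u

lemma unitVal_div {d : ℕ} (u v : E d) : unitVal (u / v) = unitVal u / unitVal v := by
  rw [eq_div_iff (unitVal_ne_zero v), ← map_mul, div_mul_cancel]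

lemma unitVal_unitsIncl {d : ℕ} (u : (𝓞 (K0 d))ˣ) :
    ((unitVal (unitsIncl d u) : K1 d) : ℂ) = (((u : 𝓞 (K0 d)) : K0 d) : ℂ) := by
  rw [unitVal_apply, unitsIncl, coe_unitsMap]
  exact coe_inclusion (K0_le_K1 d) _

/-- A cube root in K₁ of a unit is integral and divides a unit, so independence modulo E³ is
independence modulo cubes of K₁. -/
lemma exists_unit_of_pow_three {d : ℕ} {u : E d} {v : K1 d} (h : v ^ 3 = unitVal u) :
    ∃ w : E d, w ^ 3 = u := by
  have hint : IsIntegral ℤ v := by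
    apply IsIntegral.of_pow (n := 3) (by norm_num)
    rw [h]
    exact NumberField.RingOfIntegers.isIntegral_coe _
  let V : 𝓞 (K1 d) := ⟨v, hint⟩
  have hV : V ^ 3 = u := by
    apply NumberField.RingOfIntegers.ext
    exact (map_pow (algebraMap (𝓞 (K1 d)) (K1 d)) V 3).trans h
  have hu : IsUnit V := (isUnit_pow_iff (n := 3) (by norm_num)).1 (hV ▸ u.isUnit)
  exact ⟨hu.unit, Units.ext (by rw [Units.val_pow_eq_pow_val, IsUnit.unit_spec, hV])⟩

/-- The trivial class is also represented by the zero exponent vector, and its representation is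
unique. -/
lemma IsBasisM.eq_zero_of_pow_three {d : ℕ} {g : K1 d ≃ₐ[ℚ] K1 d} {ε : Fin 3 → E d}
    (h : IsBasisM g ε) (c : Fin 3 → Fin 3) {w : E d} (hw : w ^ 3 = ∏ j, ε j ^ (c j : ℕ)) :
    c = 0 := by
  obtain ⟨c', -, hc'⟩ := h.2 1 (one_mem _)
  have h1 : c = c' := by
    apply hc'
    simp_rw [← map_pow]
    rw [← map_prod, ← hw]
    symm
    exact (QuotientGroup.eq_one_iff _).2 ⟨w, rfl⟩
  have h2 : (0 : Fin 3 → Fin 3) = c' := by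
    apply hc'
    simp
  rw [h1, h2]

lemma IsBasisM.exists_eq {d : ℕ} {g : K1 d ≃ₐ[ℚ] K1 d} {ε : Fin 3 → E d}
    (h : IsBasisM g ε) (j : Fin 3) : ∃ w v : E d, ε j = w / act g w * v ^ 3 := by
  obtain ⟨m, ⟨w, rfl⟩, hm⟩ := h.1 j
  obtain ⟨v, hv⟩ := QuotientGroup.eq.1 hm
  refine ⟨w, v, ?_⟩
  have hv' : v ^ 3 = (w / act g w)⁻¹ * ε j := hv
  rw [hv', mul_inv_cancel_left]

lemma IsSpecialSystem.specialTriple {d : ℕ} {g τ : K1 d ≃ₐ[ℚ] K1 d} {ε : Fin 3 → E d}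
    (h : IsSpecialSystem g τ ε) (hg : ∀ x, toRat g (toRat g x) = x) (hτ : GeneratesGal τ (K0 d)) :
    SpecialTriple (toRat g) (toRat τ) (fun j => unitVal (ε j)) := by
  refine ⟨fun j => unitVal_ne_zero _, ?_, ?_, ?_, ?_, ?_⟩
  · intro c v hv
    have hv' : v ^ 3 = unitVal (∏ j, ε j ^ (c j).val) := by
      rw [hv, map_prod]
      simp_rw [map_pow]
    obtain ⟨w, hw⟩ := exists_unit_of_pow_three hv'
    exact h.basis.eq_zero_of_pow_three c hw
  · intro j
    obtain ⟨w, v, hwv⟩ := h.basis.exists_eq j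
    -- With εⱼ = w/g(w) · v³ and g² = 1, the product εⱼ · g(εⱼ) is (v · g(v))³.
    refine ⟨unitVal v * toRat g (unitVal v), ?_⟩
    have hw0 := unitVal_ne_zero w
    have hgw0 : toRat g (unitVal w) ≠ 0 := (_root_.map_ne_zero _).2 hw0
    have hv0 := unitVal_ne_zero v
    simp only [hwv, map_mul, unitVal_div, map_pow, unitVal_act, map_div₀, hg]
    field_simp
  · obtain ⟨u, -, hu⟩ := h.fundamental
    refine hτ.fixes _ ?_
    simp only [hu, unitVal_unitsIncl]
    exact Subtype.prop _
  · rw [← h.one_sub, ← unitVal_act, ← map_mul, div_mul_cancel]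
  · rw [← unitVal_act, ← unitVal_act, ← map_mul, ← map_mul]
    rcases h.norm with hN | hN
    · exact ⟨1, by rw [hN, pow_one]⟩
    · exact ⟨0, by rw [hN, map_one, pow_zero]⟩

end Units

/-! ### The group Gal(K₁/ℚ) and assembly of the proof -/

section Generators

attribute [local instance] ratAlgebra ratModule

variable {d : ℕ} {g τ : K1 d ≃ₐ[ℚ] K1 d}

lemma orderOf_mul_finrank_K1 (hd : ¬ 3 ∣ d) {k : IntermediateField ℚ ℂ} (hle : k ≤ K1 d)
    (hg : ∀ t : K1 d ≃ₐ[ℚ] K1 d, t ∈ Subgroup.zpowers g ↔ ∀ x : K1 d, (x : ℂ) ∈ k → t x = x) :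
    orderOf g * Module.finrank ℚ k = 6 := by
  have := finiteDimensional_K1 hd
  have := normal_K1 hd
  have : IsGalois ℚ (K1 d) := {}
  rw [← finrank_K1 hd]
  exact orderOf_mul_finrank hle hg

lemma natCard_aut_K1 (hd : ¬ 3 ∣ d) : Nat.card (K1 d ≃ₐ[ℚ] K1 d) = 6 := by
  have := finiteDimensional_K1 hd
  have := normal_K1 hd
  have : IsGalois ℚ (K1 d) := {}
  rw [IsGalois.card_aut_eq_finrank, finrank_K1 hd]

lemma aut_K1_ext (h1 : g (q1 d) = τ (q1 d)) (h2 : g (b1 d) = τ (b1 d)) : g = τ := by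
  have h : g.toAlgHom = τ.toAlgHom := by
    refine algHom_ext_generators (K1_eq d) ?_
    rintro ⟨x, hx⟩ (rfl | rfl)
    · exact h1
    · exact h2
  exact AlgEquiv.ext fun x => DFunLike.congr_fun h x

lemma map_q1 (s : K1 d ≃ₐ[ℚ] K1 d) : s (q1 d) = q1 d ∨ s (q1 d) = -q1 d := by
  rcases map_qK ((K1 d).val.comp s.toAlgHom) (x := q1 d) rfl with h | h
  · exact Or.inl (Subtype.ext h)
  · exact Or.inr (Subtype.ext h)

/-- Degrees give `g` order 2 and `τ` order 3, so together they generate the group of order 6. The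
premise of `hD` reflects that the inversion of classes by `g` relies on g² = 1. -/
lemma descendsInvolution_cubeField (hd : ¬ 3 ∣ d)
    (hg : ∀ t : K1 d ≃ₐ[ℚ] K1 d, t ∈ Subgroup.zpowers g ↔ ∀ x : K1 d, (x : ℂ) ∈ B1 → t x = x)
    (hτ : ∀ t : K1 d ≃ₐ[ℚ] K1 d, t ∈ Subgroup.zpowers τ ↔ ∀ x : K1 d, (x : ℂ) ∈ K0 d → t x = x)
    {e : Fin 3 → K1 d} (hD : (∀ x, g (g x) = x) → SpecialTriple g τ e) {i : ℕ} (hi : 1 ≤ i)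
    (hi' : i ≤ 3) : DescendsInvolution d i (cubeField e i) := by
  have hog : orderOf g = 2 := by
    have := orderOf_mul_finrank_K1 hd (B1_le_K1 d) hg
    rw [finrank_B1.2] at this
    omega
  have hoτ : orderOf τ = 3 := by
    have := orderOf_mul_finrank_K1 hd (K0_le_K1 d) hτ
    rw [(finrank_K0 hd).2] at this
    omega
  have hgb : g (b1 d) = b1 d := (hg g).1 (Subgroup.mem_zpowers g) _ bB_mem_B1
  have hτq : τ (q1 d) = q1 d := (hτ τ).1 (Subgroup.mem_zpowers τ) _ (qK_mem_K0 d)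
  have hgq : g (q1 d) = -q1 d := by
    refine (map_q1 g).resolve_left fun h => ?_
    have h1 : g = 1 := aut_K1_ext h hgb
    rw [h1, orderOf_one] at hog
    norm_num at hog
  have hτb : τ (b1 d) ≠ b1 d := by
    intro h
    have h1 : τ = 1 := aut_K1_ext hτq h
    rw [h1, orderOf_one] at hoτ
    norm_num at hoτ
  have hgg : ∀ x, g (g x) = x := fun x => by
    rw [← AlgEquiv.mul_apply, ← pow_two, ← hog, pow_orderOf_eq_one, AlgEquiv.one_apply]
  have hτ3 : τ ^ 3 = 1 := by rw [← hoτ, pow_orderOf_eq_one]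
  have := finiteDimensional_K1 hd
  have hgen := closure_pair_eq_top hog hoτ (by norm_num) (natCard_aut_K1 hd)
  have D := hD hgg
  have := finiteDimensional_cubeField hd e i
  have := normal_cubeField hd D hgen i
  have : IsGalois ℚ (cubeField e i) := {}
  exact descendsInvolution_of_exists hd (coe_rE e i) (coe_bE e i)
    (finrank_cubeField hd D hgq hgb hi')
    (exists_descent_cubeField hd D hgq hgb hτq hτb hτ3 hi)

end Generators

lemma Htilde_eq_cubeField (d : ℕ) (ε : Fin 3 → E d) (i : ℕ) :
    Htilde d ε i = cubeField (fun j => unitVal (ε j)) i := rfl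

end KummerLambda

theorem proposition5 (d : ℕ) (hd : ¬ 3 ∣ d)
    (g τ : KummerLambda.K1 d ≃ₐ[ℚ] KummerLambda.K1 d)
    (hg : KummerLambda.GeneratesGal g KummerLambda.B1)
    (hτ : KummerLambda.GeneratesGal τ (KummerLambda.K0 d))
    (ε : Fin 3 → KummerLambda.E d) (hε : KummerLambda.IsSpecialSystem g τ ε)
    (i : ℕ) (hi : 1 ≤ i) (hi' : i ≤ 3) :
    ∃ γ : KummerLambda.Htilde d ε i ≃ₐ[ℚ] KummerLambda.Htilde d ε i,
      -- `γ` is the unique element of order 2 of `Gal(H̃ᵢ/F₁)`, so its fixed field is `Hᵢ`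
      (∀ s : KummerLambda.Htilde d ε i ≃ₐ[ℚ] KummerLambda.Htilde d ε i,
        (KummerLambda.Fixes s (KummerLambda.F1 d) ∧ orderOf s = 2) ↔ s = γ) ∧
      ∃ H' : IntermediateField (KummerLambda.F0 d) ℂ,
        Module.finrank (KummerLambda.F0 d) H' = 3 ^ i ∧
        KummerLambda.fixedFieldOf γ = KummerLambda.F1 d ⊔ H'.restrictScalars ℚ := by
  apply KummerLambda.DescendsInvolution.exists_fixedFieldOf
  rw [KummerLambda.Htilde_eq_cubeField]
  exact KummerLambda.descendsInvolution_cubeField hd hg.toRat_iff hτ.toRat_iff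
    (fun hgg => hε.specialTriple hgg hτ) hi hi'
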